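/- Let $G$ be a finite group acting faithfully by conformal automorphisms on a closed connected Riemann surface $S$, and let $\pi_G:S\to T=S/G$ be the holomorphic quotient map onto the quotient Riemann surface; the cone points of $T$ are the images of the points of $S$ with nontrivial stabilizer. Let $\mathcal E$ be a cut system in $T$: an embedded graph with finitely many vertices and $k$ edges such that all cone points are vertices; the edges are smooth arcs, regular up to their end points, that meet (themselves or each other) only at vertices; the edge ends meeting at a vertex have pairwise distinct tangent directions there; a vertex of valence $1$ is a cone point; and $T-\mathcal E$ is an open disc. (Edges may be loops; a loop counts twice for the valence.) Fix a point $\tilde v_0\in S$ with $v_0=\pi_G(\tilde v_0)\notin\mathcal E$, let $\mathcal P^\circ$ be the component of $S-\pi_G^{-1}(\mathcal E)$ containing $\tilde v_0$, and call $g\mathcal P^\circ$ ($g\in G$) the open polygon with label $g$. Let $\xi$ be the monodromy: for a loop $\gamma$ at $v_0$ avoiding the cone points, the lift of $\gamma$ starting at $\tilde v_0$ ends at $\xi(\gamma)\tilde v_0$. For each oriented edge $e$ of $\mathcal E$ choose a crossover loop $\delta_e$, that is, a simple loop at $v_0$ which meets $\mathcal E$ in exactly one point, interior to the edge, and crosses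 the edge there transversally from the right of $e$ to the left of $e$; put $\tau_e=\xi(\delta_e)$. For an oriented edge $e$ issuing from a vertex $v$, the sector of type $e$ at $v$ is the sector, cut out near $v$ by $\mathcal E$, that immediately precedes $e$ in the counterclockwise order around $v$. Each $g\mathcal P^\circ$ contains exactly one lift of each of these $2k$ sectors, its corner of type $e$; the tip of this corner is a point of $S$ over $v$, and these $2k$ tips are the images in $S$ of the $2k$ vertices of the boundary circle of the polygon. There is a vertex collapse at $\tilde v\in S$ if two distinct boundary vertices of one lifted polygon are identified at $\tilde v$, i.e. if for some $g\in G$ and some oriented edges $e\ne e'$ the tips of the corners of types $e$ and $e'$ of $g\mathcal P^\circ$ are both equal to $\tilde v$. Let $\tilde v\in S$ lie over a vertex $v$ of $\mathcal E$ of valence $k_v\geq 1$, and let $m_v$ be the order of the stabilizer $G_{\tilde v}$. Let $e_1,\dots,e_{k_v}$ be the oriented edges issuing from $v$, in counterclockwise order starting with any one of them, and continue this list periodically by $e_{i+k_v}=e_i$. Let $h\in G$ be the label of a sector at $\tilde v$ lying over the sector of type $e_1$ (that is, the corner of type $e_1$ of $h\mathcal P^\circ$ has its tip at $\tilde v$).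 Then there is a vertex collapse at $\tilde v$ if and only if the sector labelling sequence $$h,\quad h\tau_{e_1},\quad h\tau_{e_1}\tau_{e_2},\quad h\tau_{e_1}\tau_{e_2}\tau_{e_3},\quad\dots$$ of length $k_v m_v$ has a repetition, i.e. two of its terms, at different positions, are equal. -/

import Mathlib

open Set Filter Topology
open scoped Manifold ContDiff Pointwise ComplexConjugate

noncomputable section

/-! ### The quotient map -/

/-- The finite group `G` acts by conformal automorphisms on the Riemann surface `S`, and
`p : S → T` is the holomorphic quotient map onto the Riemann surface `T = S / G`: it is onto
and its fibres are exactly the orbits. (The complex structure on the quotient is the only one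
for which such a `p` is holomorphic.) -/
structure IsConformalQuotient (G : Type*) {S T : Type*} [Group G] [MulAction G S]
    [TopologicalSpace S] [ChartedSpace ℂ S] [TopologicalSpace T] [ChartedSpace ℂ T]
    (p : S → T) : Prop where
  conformal : ∀ g : G, MDifferentiable 𝓘(ℂ) 𝓘(ℂ) (fun x : S => g • x)
  holomorphic : MDifferentiable 𝓘(ℂ) 𝓘(ℂ) p
  surjective : Function.Surjective p
  fibre : ∀ x y : S, p x = p y ↔ ∃ g : G, g • x = y

/-- `z` is a cone point of `T = S / G`: the points over it have nontrivial stabilizers. -/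
def IsConePoint (G : Type*) {S T : Type*} [Group G] [MulAction G S] (p : S → T) (z : T) : Prop :=
  ∃ x : S, p x = z ∧ MulAction.stabilizer G x ≠ ⊥

/-! ### Tangents -/

/-- The velocity at time `t` of a curve `c : [0,1] → T`, in the chart of `T` at the point `c t`
(one-sided at the end points). -/
def velocity {T : Type*} [TopologicalSpace T] [ChartedSpace ℂ T] (c : ℝ → T) (t : ℝ) : ℂ :=
  derivWithin (fun s => chartAt ℂ (c t) (c s)) (Icc 0 1) t

/-- The counterclockwise angle in `[0, 2π)` from the direction `a` to the direction `b`. -/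
def ccwAngle (a b : ℂ) : ℝ :=
  toIcoMod Real.two_pi_pos 0 (Complex.arg (b / a))

/-! ### Systems of arcs and cut systems -/

/-- A finite set of points of `T` (the vertices) and finitely many curves `[0,1] → T`
(the edges); only the values of `arc e` on `[0,1]` matter. -/
structure ArcSystem (T : Type*) where
  vertices : Finset T
  numEdges : ℕ
  arc : Fin numEdges → ℝ → T

namespace ArcSystem

variable {T : Type*}

/-- The subset of `T` formed by the vertices and edges. -/
def carrier (E : ArcSystem T) : Set T :=
  (E.vertices : Set T) ∪ ⋃ e, E.arc e '' Icc (0 : ℝ) 1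

/-- Oriented edges: `(e, false)` is `e` with the orientation of its parametrization,
`(e, true)` is `e` with the opposite orientation. -/
abbrev OrientedEdge (E : ArcSystem T) : Type := Fin E.numEdges × Bool

/-- The parametrization of an oriented edge, run in the direction of its orientation. -/
def path (E : ArcSystem T) (d : E.OrientedEdge) (t : ℝ) : T :=
  if d.2 then E.arc d.1 (1 - t) else E.arc d.1 t

/-- The vertex from which an oriented edge issues. -/
def start (E : ArcSystem T) (d : E.OrientedEdge) : T := E.path d 0

/-- The valence `k_v`: the number of oriented edges issuing from `v` (a loop counts twice). -/
def valence (E : ArcSystem T) (v : T) : ℕ := {d : E.OrientedEdge | E.start d = v}.ncard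

variable [TopologicalSpace T] [ChartedSpace ℂ T]

/-- The tangent of an oriented edge at the vertex from which it issues, in the chart there. -/
def direction (E : ArcSystem T) (d : E.OrientedEdge) : ℂ := velocity (E.path d) 0

/-- Cut systems in `T = S / G`. -/
structure IsCutSystem (E : ArcSystem T) (G : Type*) {S : Type*} [Group G] [MulAction G S]
    (p : S → T) : Prop where
  /-- All cone points are vertices. -/
  cone_mem : ∀ z, IsConePoint G p z → z ∈ E.vertices
  /-- The edges are smooth arcs (`C¹` suffices), regular up to their end points. -/
  smooth : ∀ e, ContMDiffOn 𝓘(ℝ, ℝ) 𝓘(ℝ, ℂ) 1 (E.arc e) (Icc 0 1)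
  regular : ∀ e, ∀ t ∈ Icc (0 : ℝ) 1, velocity (E.arc e) t ≠ 0
  /-- Edges begin and end at vertices. -/
  endpoints : ∀ e, E.arc e 0 ∈ E.vertices ∧ E.arc e 1 ∈ E.vertices
  /-- There are no intersections or self-intersections of edges except at vertices, and the
  interior of an edge contains no vertex. -/
  interior : ∀ e, ∀ t ∈ Ioo (0 : ℝ) 1, E.arc e t ∉ E.vertices
  embedded : ∀ e e', ∀ t ∈ Ioo (0 : ℝ) 1, ∀ t' ∈ Ioo (0 : ℝ) 1,
    E.arc e t = E.arc e' t' → e = e' ∧ t = t'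
  /-- The edge ends that meet at a vertex have pairwise distinct tangents. -/
  distinct_tangents : ∀ d d' : E.OrientedEdge, d ≠ d' → E.start d = E.start d' →
    ¬ SameRay ℝ (E.direction d) (E.direction d')
  /-- A regular point of `T` is not a terminal vertex. -/
  terminal : ∀ v ∈ E.vertices, E.valence v = 1 → IsConePoint G p v
  /-- The complement is an open disc. -/
  disc : Nonempty (↥(E.carrierᶜ) ≃ₜ ↥(Metric.ball (0 : ℂ) 1))

/-- `e 0, e 1, e 2, …` lists the oriented edges issuing from `v` in counterclockwise order, round
after round (period `k_v`). -/
structure IsCounterclockwise (E : ArcSystem T) (v : T) (e : ℕ → E.OrientedEdge) : Prop where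
  enumerates : BijOn e (Iio (E.valence v)) {d | E.start d = v}
  increasing : StrictMonoOn (fun i => ccwAngle (E.direction (e 0)) (E.direction (e i)))
    (Iio (E.valence v))
  periodic : ∀ i, e (i + E.valence v) = e i

/-! ### Crossover loops and crossover transformations -/

/-- The loop `δ` is a crossover loop for the oriented edge `d`: it is simple, it meets the graph
in exactly one point, which is interior to the edge, and it crosses the edge there transversally,
from the right-hand side to the left-hand side of `d`. (The opposite crossing is the one that
belongs to the oppositely oriented edge.) -/
structure IsCrossoverLoop (E : ArcSystem T) (d : E.OrientedEdge) {z : T} (δ : Path z z) :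
    Prop where
  simple : InjOn δ.extend (Ico 0 1)
  crosses : ∃ t₀ ∈ Ioo (0 : ℝ) 1, ∃ s₀ ∈ Ioo (0 : ℝ) 1,
    δ.extend t₀ = E.path d s₀ ∧
    0 < (conj (velocity (E.path d) s₀) * velocity δ.extend t₀).im ∧
    ∀ t ∈ Icc (0 : ℝ) 1, δ.extend t ∈ E.carrier → t = t₀

end ArcSystem

/-- The monodromy `ξ(γ)` of a loop `γ` in the punctured quotient, based at `p x₀`, by path
lifting: the lift of `γ` that begins at `x₀` ends at `ξ(γ) • x₀`. -/
def monodromy (G : Type*) {S T : Type*} [Group G] [MulAction G S] [TopologicalSpace S]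
    [TopologicalSpace T] (p : S → T) (x₀ : S) (γ : Path (p x₀) (p x₀)) : G :=
  Classical.epsilon fun g : G => ∃ Γ : Path x₀ (g • x₀), ∀ t, p (Γ t) = γ t

namespace ArcSystem

/-! ### Lifted polygons, their corners, and vertex collapse -/

variable {S T : Type*} [TopologicalSpace S]

/-- The distinguished open polygon: the component of `S - p⁻¹(E)` that contains `x₀`. The other
open polygons are its translates `g • E.polygon p x₀`, with label `g`. -/
def polygon (E : ArcSystem T) (p : S → T) (x₀ : S) : Set S :=
  connectedComponentIn (p ⁻¹' E.carrierᶜ) x₀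

variable [TopologicalSpace T] [ChartedSpace ℂ T]

/-- The straight ray, in the chart at the vertex `v = E.start d`, that leaves `v` at the angle `θ`
clockwise from the oriented edge `d`. For each small `θ > 0` this ray runs, near `v`, inside
the sector at `v` from which one crosses `d` when going counterclockwise around `v`. -/
def ray (E : ArcSystem T) (d : E.OrientedEdge) (θ : ℝ) : Set T :=
  {x | x ∈ (chartAt ℂ (E.start d)).source ∧ ∃ r : ℝ, 0 < r ∧
    chartAt ℂ (E.start d) x = chartAt ℂ (E.start d) (E.start d) +
      r * Complex.exp (-θ * Complex.I) * E.direction d}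

/-- The `2k` sectors cut out by the graph at its vertices correspond to the `2k` oriented edges
`d` (the sector just clockwise of `d`). Each open polygon `g P` contains one lift of each of
them, its corner of type `d`, and the tips of the corners are the `2k` vertices of the boundary
circle of `g P`. `E.CornerAt p x₀ g d w` says that the tip of the corner of type `d` of `g P` is
the point `w` of `S`; then `g` is the label of that sector at `w`. -/
def CornerAt {G : Type*} [Group G] [MulAction G S] (E : ArcSystem T) (p : S → T) (x₀ : S)
    (g : G) (d : E.OrientedEdge) (w : S) : Prop :=
  p w = E.start d ∧ ∀ᶠ θ in 𝓝[>] (0 : ℝ), w ∈ closure ((g • E.polygon p x₀) ∩ p ⁻¹' E.ray d θ)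

/-- There is a vertex collapse at `w`: two different vertices of the boundary circle of some
lifted polygon `g P` are identified at `w`. -/
def VertexCollapse (G : Type*) [Group G] [MulAction G S] (E : ArcSystem T) (p : S → T) (x₀ : S)
    (w : S) : Prop :=
  ∃ (g : G) (d d' : E.OrientedEdge), d ≠ d' ∧ E.CornerAt p x₀ g d w ∧ E.CornerAt p x₀ g d' w

end ArcSystem

/-- The sequence `h, h τ₀, h τ₀ τ₁, h τ₀ τ₁ τ₂, …`. -/
def labelSequence {G : Type*} [Group G] (h : G) (τ : ℕ → G) : ℕ → G
  | 0 => h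
  | i + 1 => labelSequence h τ i * τ i

end

/-! Walk counterclockwise around the point `w` of `S`. Crossing an edge `d` from right to left
always turns a label `g` into `g * τ d`, so the labelling sequence lists the labels of the sectors
met. There are `k` sectors at `p w`; one turn around `p w` lifts to a walk through `k` sectors at
`w`, and its effect is the action of a generator `s` of the stabilizer of `w`, which is cyclic of
order `m`. Hence the `k * m` terms belong to the `k * m` different sectors at `w`. A vertex collapse
says that two of these sectors have different types and the same label. Two different sectors of the
same type are related by some `s ^ q` with `0 < q < m`; since `s ^ q` multiplies labels on the left,
their labels differ. So every repetition of a label is a collapse, and conversely.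

Three facts carry this. Labels exist and are unique (`exists_mem_smul_polygon`, `smul_polygon_inj`):
the complement of the graph is a disc without cone points, so it lifts to `S`.

The crossing rule holds: in straightened coordinates (`exists_straightening`) each side of an edge
lies in one polygon, and the quotient of the two labels does not depend on the chosen lift, because
`G` acts on labels from the left. This quotient is locally constant along the edge
(`exists_hasCrossing`) and can be read off from any crossover loop (`hasCrossing_monodromy`).

Finally there is a local model at `w`: in logarithmic polar coordinates the edge ends become
disjoint graphs over a half-line (`exists_logPolar_param`, `exists_sectors`), and the half-plane,
being simply connected, lifts to a punctured neighbourhood of `w` (`exists_isLogPolarLift`).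
`vertexCollapse_iff` then counts sectors in this model. -/

set_option linter.unusedSectionVars false

/-! ### Orbit maps of finite groups: covering away from cone points, lifting. -/

/-- `p : S → T` is a continuous surjection whose fibres are the orbits of `G`. -/
structure IsOrbitMap (G : Type*) {S T : Type*} [Group G] [MulAction G S]
    [TopologicalSpace S] [TopologicalSpace T] (p : S → T) : Prop where
  continuous : Continuous p
  surjective : Function.Surjective p
  fibre : ∀ x y : S, p x = p y ↔ ∃ g : G, g • x = y

/-- Each `g` that moves `x` is handled by separating `g • x` from `x`; finiteness of `G` allows
intersecting the resulting neighbourhoods. -/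
theorem exists_isOpen_smul_inter_nonempty (G : Type*) {S : Type*} [TopologicalSpace S] [T2Space S]
    [Group G] [Finite G] [MulAction G S] [ContinuousConstSMul G S] (x : S) :
    ∃ W : Set S, IsOpen W ∧ x ∈ W ∧
      ∀ g : G, (((g • ·) '' W) ∩ W).Nonempty → g • x = x := by
  have key : ∀ g : G, ∃ W : Set S, IsOpen W ∧ x ∈ W ∧
      ((((g • ·) '' W) ∩ W).Nonempty → g • x = x) := by
    intro g
    by_cases hg : g • x = x
    · exact ⟨univ, isOpen_univ, mem_univ _, fun _ => hg⟩
    · obtain ⟨A, B, hA, hB, hxA, hxB, hAB⟩ := t2_separation hg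
      refine ⟨B ∩ (g • ·) ⁻¹' A, hB.inter (hA.preimage (continuous_const_smul g)),
        ⟨hxB, hxA⟩, ?_⟩
      rintro ⟨_, ⟨y, hy, rfl⟩, hy'⟩
      exact absurd hy'.1 (disjoint_left.1 hAB hy.2)
  choose W hW hxW hgW using key
  refine ⟨⋂ g, W g, isOpen_iInter_of_finite hW, mem_iInter.2 hxW, fun g hg => hgW g ?_⟩
  obtain ⟨_, ⟨y, hy, rfl⟩, hy'⟩ := hg
  exact ⟨_, ⟨y, mem_iInter.1 hy g, rfl⟩, mem_iInter.1 hy' g⟩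

theorem mul_smul_mem_mul_smul {G S : Type*} [Group G] [MulAction G S] {V : Set S} {g g' : G} {x : S} (hx : x ∈ g • V) :
    g' • x ∈ (g' * g) • V := by
  rw [mul_smul]
  exact smul_mem_smul_set hx

namespace IsOrbitMap

variable {S T G : Type*} [TopologicalSpace S] [TopologicalSpace T] [Group G] [MulAction G S]
  {p : S → T}

theorem map_smul (hp : IsOrbitMap G p) (g : G) (x : S) : p (g • x) = p x :=
  ((hp.fibre x (g • x)).2 ⟨g, rfl⟩).symm

theorem eq_one_of_smul_eq {x : S} {g : G} (hx : ¬ IsConePoint G p (p x)) (hg : g • x = x) :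
    g = 1 := by
  by_contra hne
  refine hx ⟨x, rfl, fun h => hne ?_⟩
  have : g ∈ MulAction.stabilizer G x := hg
  rwa [h, Subgroup.mem_bot] at this

theorem smul_left_cancel {x : S} {g g' : G} (hx : ¬ IsConePoint G p (p x))
    (hg : g • x = g' • x) : g = g' := by
  have : (g'⁻¹ * g) • x = x := by rw [mul_smul, hg, inv_smul_smul]
  exact (inv_mul_eq_one.1 (eq_one_of_smul_eq hx this)).symm

theorem isQuotientMap [CompactSpace S] [T2Space T] (hp : IsOrbitMap G p) : IsQuotientMap p :=
  hp.continuous.isClosedMap.isQuotientMap hp.continuous hp.surjective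

theorem isOpenMap [CompactSpace S] [T2Space T] [ContinuousConstSMul G S]
    (hp : IsOrbitMap G p) : IsOpenMap p := by
  intro W hW
  rw [← hp.isQuotientMap.isOpen_preimage]
  have : p ⁻¹' (p '' W) = ⋃ g : G, (g • ·) ⁻¹' W := by
    ext x
    simp only [mem_preimage, mem_image, mem_iUnion]
    constructor
    · rintro ⟨y, hy, h⟩
      obtain ⟨g, rfl⟩ := (hp.fibre x y).1 h.symm
      exact ⟨g, hy⟩
    · rintro ⟨g, hg⟩
      exact ⟨_, hg, hp.map_smul g x⟩
  rw [this]
  exact isOpen_iUnion fun g => hW.preimage (continuous_const_smul g)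

/-- Over a non-cone point the stabilizers are trivial, so a small neighbourhood is disjoint from all
its other translates. Compactness of `S` makes `p` closed, hence a quotient map. -/
theorem isCoveringMapOn [T2Space S] [CompactSpace S] [T2Space T] [Finite G]
    [ContinuousConstSMul G S] (hp : IsOrbitMap G p) :
    IsCoveringMapOn p {z | ¬ IsConePoint G p z} := by
  refine (hp.isQuotientMap.isCoveringMapOn_of_smul_disjoint (G := G) ?_ ?_).mono ?_
  · intro x y
    rw [hp.fibre]
    constructor
    · rintro ⟨g, rfl⟩
      exact ⟨g⁻¹, inv_smul_smul g x⟩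
    · rintro ⟨g, rfl⟩
      exact ⟨g⁻¹, inv_smul_smul g y⟩
  · intro x
    obtain ⟨W, hW, hx, h⟩ := exists_isOpen_smul_inter_nonempty G x
    exact ⟨W, hW.mem_nhds hx, h⟩
  · intro z hz
    obtain ⟨x, rfl⟩ := hp.surjective z
    refine ⟨x, ?_, rfl⟩
    by_contra h
    exact hz ⟨x, rfl, h⟩

theorem exists_isOpen_injOn [T2Space S] [Finite G] [ContinuousConstSMul G S]
    (hp : IsOrbitMap G p) {x : S} (hx : ¬ IsConePoint G p (p x)) :
    ∃ O : Set S, IsOpen O ∧ x ∈ O ∧ InjOn p O := by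
  obtain ⟨W, hW, hxW, h⟩ := exists_isOpen_smul_inter_nonempty G x
  refine ⟨W, hW, hxW, fun y hy y' hy' hyy' => ?_⟩
  obtain ⟨g, rfl⟩ := (hp.fibre y y').1 hyy'
  have : g = 1 := eq_one_of_smul_eq hx (h g ⟨_, ⟨y, hy, rfl⟩, hy'⟩)
  rw [this, one_smul]

/-- Germ form of uniqueness of lifts: `p` is injective near a point with trivial stabilizer. Only
limits are required, so it serves both for clopen arguments and for comparing lifted curves at one
instant. -/
theorem eventuallyEq_of_tendsto [T2Space S] [Finite G] [ContinuousConstSMul G S]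
    (hp : IsOrbitMap G p) {x : S} (hx : ¬ IsConePoint G p (p x)) {A : Type*} {l : Filter A}
    {f f' : A → S} (hf : Tendsto f l (𝓝 x)) (hf' : Tendsto f' l (𝓝 x))
    (h : ∀ᶠ a in l, p (f a) = p (f' a)) : f =ᶠ[l] f' := by
  obtain ⟨O, hO, hxO, hinj⟩ := hp.exists_isOpen_injOn hx
  filter_upwards [hf (hO.mem_nhds hxO), hf' (hO.mem_nhds hxO), h] with a ha ha' haa'
  exact hinj ha ha' haa'

theorem eqOn_of_isPreconnected [T2Space S] [Finite G] [ContinuousConstSMul G S]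
    (hp : IsOrbitMap G p) {A : Type*} [TopologicalSpace A] {R : Set A} (hR : IsPreconnected R)
    {f f' : A → S} (hf : ContinuousOn f R) (hf' : ContinuousOn f' R)
    (hc : ∀ a ∈ R, ¬ IsConePoint G p (p (f a))) (h : ∀ a ∈ R, p (f a) = p (f' a))
    {a₀ : A} (ha₀ : a₀ ∈ R) (h₀ : f a₀ = f' a₀) : EqOn f f' R := by
  have : PreconnectedSpace R := isPreconnected_iff_preconnectedSpace.1 hR
  have hcl : IsClopen {a : R | f a = f' a} := by
    refine ⟨isClosed_eq hf.domRestrict hf'.domRestrict, isOpen_iff_mem_nhds.2 fun a ha => ?_⟩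
    have h1 : Tendsto (fun b : R => f b) (𝓝 a) (𝓝 (f a)) := hf.domRestrict.continuousAt
    have h2 : Tendsto (fun b : R => f' b) (𝓝 a) (𝓝 (f' a)) := hf'.domRestrict.continuousAt
    rw [← show f a = f' a from ha] at h2
    exact hp.eventuallyEq_of_tendsto (hc a a.2) h1 h2 (Eventually.of_forall fun b => h b b.2)
  intro a ha
  have := hcl.eq_univ ⟨⟨a₀, ha₀⟩, h₀⟩
  have h3 : (⟨a, ha⟩ : R) ∈ {a : R | f a = f' a} := this ▸ mem_univ _
  exact h3

/-- Convex sets are contractible and locally path connected, so the lifting criterion for coverings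
applies. It is used for a disc, an interval and a half-plane. -/
theorem exists_lift_of_convex [T2Space S] [CompactSpace S] [T2Space T] [Finite G]
    [ContinuousConstSMul G S] (hp : IsOrbitMap G p) {F : Type*} [NormedAddCommGroup F]
    [NormedSpace ℝ F] {R : Set F} (hR : Convex ℝ R) {f : F → T} (hf : ContinuousOn f R)
    (hc : ∀ a ∈ R, ¬ IsConePoint G p (f a)) {a₀ : F} (ha₀ : a₀ ∈ R) {x : S} (hx : p x = f a₀) :
    ∃ f' : F → S, ContinuousOn f' R ∧ f' a₀ = x ∧ ∀ a ∈ R, p (f' a) = f a := by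
  have : ContractibleSpace R := hR.contractibleSpace ⟨a₀, ha₀⟩
  have : LocallyPathConnectedSpace R := hR.locallyPathConnectedSpace
  obtain ⟨f', ⟨h₀, h⟩, -⟩ := hp.isCoveringMapOn.existsUnique_continuousMap_lifts
    (⟨R.domRestrict f, hf.domRestrict⟩ : C(R, T)) (a₀ := ⟨a₀, ha₀⟩) (e₀ := x) hx
    (fun a => hc a a.2)
  classical
  refine ⟨fun a => if ha : a ∈ R then f' ⟨a, ha⟩ else x, ?_, ?_, ?_⟩
  · rw [continuousOn_iff_continuous_domRestrict]
    convert f'.continuous using 1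
    ext a
    simp
  · simp [ha₀, h₀]
  · intro a ha
    simp only [ha, dif_pos]
    exact congrFun h ⟨a, ha⟩

end IsOrbitMap

/-! ### Lifts of an open disc free of cone points: translates and labels. -/

section Sheets

variable {S T G : Type*} [TopologicalSpace S] [T2Space S] [CompactSpace S] [TopologicalSpace T]
  [T2Space T] [Group G] [Finite G] [MulAction G S] [ContinuousConstSMul G S] {p : S → T}
  {U : Set T} {x₀ : S}

/-- A section is a lift of the identity; the homeomorphism moves the lifting problem to the unit
disc, which is convex. -/
theorem IsOrbitMap.exists_section (hp : IsOrbitMap G p) (hc : ∀ z ∈ U, ¬ IsConePoint G p z)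
    (hdisc : Nonempty (U ≃ₜ Metric.ball (0 : ℂ) 1)) (hx₀ : p x₀ ∈ U) :
    ∃ q : T → S, ContinuousOn q U ∧ q (p x₀) = x₀ ∧ ∀ z ∈ U, p (q z) = z := by
  obtain ⟨φ⟩ := hdisc
  classical
  set f : ℂ → T := fun a => if ha : a ∈ Metric.ball (0 : ℂ) 1 then (φ.symm ⟨a, ha⟩ : T) else p x₀
    with hf
  have hfφ : ∀ z : U, f (φ z) = z := fun z => by
    have : (φ z : ℂ) ∈ Metric.ball (0 : ℂ) 1 := (φ z).2
    simp only [hf, this, dif_pos]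
    simp
  have hfU : ∀ a ∈ Metric.ball (0 : ℂ) 1, f a ∈ U := fun a ha => by
    simp only [hf, ha, dif_pos]
    exact (φ.symm ⟨a, ha⟩).2
  have hfc : ContinuousOn f (Metric.ball (0 : ℂ) 1) := by
    rw [continuousOn_iff_continuous_domRestrict]
    convert continuous_subtype_val.comp φ.symm.continuous using 1
    ext a
    have : (a : ℂ) ∈ Metric.ball (0 : ℂ) 1 := a.2
    simp only [domRestrict_apply, hf, this, dif_pos]
    rfl
  obtain ⟨f', hf'c, hf'₀, hf'p⟩ := hp.exists_lift_of_convex (convex_ball (0 : ℂ) 1) hfc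
    (fun a ha => hc _ (hfU a ha)) (φ ⟨p x₀, hx₀⟩).2 (x := x₀) (hfφ ⟨p x₀, hx₀⟩).symm
  refine ⟨fun z => if hz : z ∈ U then f' (φ ⟨z, hz⟩) else x₀, ?_, ?_, ?_⟩
  · rw [continuousOn_iff_continuous_domRestrict]
    have : Continuous fun z : U => f' (φ z) :=
      hf'c.comp_continuous (continuous_subtype_val.comp φ.continuous) fun z => (φ z).2
    convert this using 1
    ext z
    simp
  · simp [hx₀, hf'₀]
  · intro z hz
    simp only [hz, dif_pos]
    rw [hf'p _ (φ ⟨z, hz⟩).2, hfφ]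

/-- With `q` the section through `x₀`, the maps `q ∘ p` and `id` are lifts of the same map on the
component and agree at `x₀`. Hence they coincide there, and `p` has a left inverse. -/
theorem IsOrbitMap.injOn_sheet (hp : IsOrbitMap G p) (hU : IsOpen U)
    (hc : ∀ z ∈ U, ¬ IsConePoint G p z) (hdisc : Nonempty (U ≃ₜ Metric.ball (0 : ℂ) 1))
    (hx₀ : p x₀ ∈ U) : InjOn p (connectedComponentIn (p ⁻¹' U) x₀) := by
  obtain ⟨q, hqc, hq₀, hqp⟩ := hp.exists_section hc hdisc hx₀
  have hO : IsOpen (p ⁻¹' U) := hU.preimage hp.continuous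
  have hqpc : ContinuousOn (fun x => q (p x)) (p ⁻¹' U) :=
    hqc.comp hp.continuous.continuousOn fun x hx => hx
  have hP : ∀ x ∈ connectedComponentIn (p ⁻¹' U) x₀, q (p x) = x :=
    hp.eqOn_of_isPreconnected isPreconnected_connectedComponentIn
      (hqpc.mono (connectedComponentIn_subset _ _)) continuousOn_id
      (fun a ha => by
        have ha' : p a ∈ U := connectedComponentIn_subset (p ⁻¹' U) x₀ ha
        rw [hqp _ ha']
        exact hc _ ha')
      (fun a ha => hqp _ (connectedComponentIn_subset (p ⁻¹' U) x₀ ha))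
      (mem_connectedComponentIn hx₀) hq₀
  intro x hx y hy hxy
  rw [← hP x hx, ← hP y hy, hxy]

/-- The image of the section is connected and contains `x₀`, so it lies in the component; `x` is a
translate of the point of this image in its fibre. -/
theorem IsOrbitMap.exists_mem_smul_sheet (hp : IsOrbitMap G p)
    (hc : ∀ z ∈ U, ¬ IsConePoint G p z) (hdisc : Nonempty (U ≃ₜ Metric.ball (0 : ℂ) 1))
    (hx₀ : p x₀ ∈ U) {x : S} (hx : p x ∈ U) :
    ∃ g : G, x ∈ g • connectedComponentIn (p ⁻¹' U) x₀ := by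
  obtain ⟨q, hqc, hq₀, hqp⟩ := hp.exists_section hc hdisc hx₀
  obtain ⟨g, hg⟩ := (hp.fibre (q (p x)) x).1 (hqp _ hx)
  refine ⟨g, q (p x), ?_, hg⟩
  have hconn : IsPreconnected U := by
    obtain ⟨φ⟩ := hdisc
    have h : IsPreconnected (Metric.ball (0 : ℂ) 1) := (convex_ball (0 : ℂ) 1).isPreconnected
    rw [isPreconnected_iff_preconnectedSpace] at h ⊢
    exact φ.symm.surjective.denseRange.preconnectedSpace φ.symm.continuous
  exact (hconn.image q hqc).subset_connectedComponentIn ⟨p x₀, hx₀, hq₀⟩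
    (by rintro _ ⟨z, hz, rfl⟩; rwa [mem_preimage, hqp z hz]) ⟨p x, hx, rfl⟩

theorem IsOrbitMap.map_mem_of_mem_smul_sheet (hp : IsOrbitMap G p) {g : G} {x : S}
    (hx : x ∈ g • connectedComponentIn (p ⁻¹' U) x₀) : p x ∈ U := by
  obtain ⟨y, hy, rfl⟩ := hx
  have := connectedComponentIn_subset _ _ hy
  simpa [hp.map_smul] using this

/-- Uniqueness of labels: `g⁻¹ • x` and `g'⁻¹ • x` are points of one sheet in one fibre, hence
equal, and `x` has trivial stabilizer. -/
theorem IsOrbitMap.smul_sheet_inj (hp : IsOrbitMap G p) (hU : IsOpen U)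
    (hc : ∀ z ∈ U, ¬ IsConePoint G p z) (hdisc : Nonempty (U ≃ₜ Metric.ball (0 : ℂ) 1))
    (hx₀ : p x₀ ∈ U) {x : S} {g g' : G} (hx : x ∈ g • connectedComponentIn (p ⁻¹' U) x₀)
    (hx' : x ∈ g' • connectedComponentIn (p ⁻¹' U) x₀) : g = g' := by
  have hxU := hp.map_mem_of_mem_smul_sheet hx
  rw [mem_smul_set_iff_inv_smul_mem] at hx hx'
  have := hp.injOn_sheet hU hc hdisc hx₀ hx hx' (by rw [hp.map_smul, hp.map_smul])
  exact inv_injective (smul_left_cancel (hc _ hxU) this)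

theorem IsOrbitMap.subset_smul_sheet (hp : IsOrbitMap G p) {C : Set S} (hC : IsPreconnected C)
    (hCU : ∀ y ∈ C, p y ∈ U) {x : S} (hxC : x ∈ C) {g : G}
    (hx : x ∈ g • connectedComponentIn (p ⁻¹' U) x₀) :
    C ⊆ g • connectedComponentIn (p ⁻¹' U) x₀ := by
  rw [mem_smul_set_iff_inv_smul_mem] at hx
  rw [connectedComponentIn_eq hx, subset_smul_set_iff]
  refine (hC.image _ (continuous_const_smul g⁻¹).continuousOn).subset_connectedComponentIn
    ⟨x, hxC, rfl⟩ ?_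
  rintro _ ⟨y, hy, rfl⟩
  simpa [hp.map_smul] using hCU y hy

end Sheets

/-! ### Changes of charts and the orientation of a crossing. -/

section Charts

variable {T : Type*} [TopologicalSpace T] [ChartedSpace ℂ T] [IsManifold 𝓘(ℂ) ω T]

theorem contDiffAt_chart_transition {z z' x : T} (hx : x ∈ (chartAt ℂ z).source)
    (hx' : x ∈ (chartAt ℂ z').source) :
    ContDiffAt ℂ 1 (chartAt ℂ z' ∘ (chartAt ℂ z).symm) (chartAt ℂ z x) := by
  have h := contDiffOn_ext_coord_change (I := 𝓘(ℂ)) (n := ω) z' z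
  have hs : ((extChartAt 𝓘(ℂ) z).symm ≫ extChartAt 𝓘(ℂ) z').source =
      ((chartAt ℂ z).symm ≫ₕ chartAt ℂ z').source := by
    ext y; simp
  rw [hs] at h
  have hmem : chartAt ℂ z x ∈ ((chartAt ℂ z).symm ≫ₕ chartAt ℂ z').source := by
    simp [(chartAt ℂ z).map_source hx, (chartAt ℂ z).left_inv hx, hx']
  have := (h.contDiffAt (((chartAt ℂ z).symm ≫ₕ chartAt ℂ z').open_source.mem_nhds hmem)).of_le
    (m := 1) le_top
  simpa using this

/-- The derivative at `x` of the change of charts from the chart at `z` to the chart at `z'`. -/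
noncomputable def chartChange (z z' x : T) : ℂ :=
  deriv (chartAt ℂ z' ∘ (chartAt ℂ z).symm) (chartAt ℂ z x)

theorem hasDerivAt_chart_transition {z z' x : T} (hx : x ∈ (chartAt ℂ z).source)
    (hx' : x ∈ (chartAt ℂ z').source) :
    HasDerivAt (chartAt ℂ z' ∘ (chartAt ℂ z).symm) (chartChange z z' x) (chartAt ℂ z x) :=
  ((contDiffAt_chart_transition hx hx').differentiableAt one_ne_zero).hasDerivAt

theorem hasDerivWithinAt_chart_comp {c : ℝ → T} {s : Set ℝ} {t : ℝ} {z z' : T} {a : ℂ}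
    (hc : ContinuousWithinAt c s t) (hz : c t ∈ (chartAt ℂ z).source)
    (hz' : c t ∈ (chartAt ℂ z').source) (h : HasDerivWithinAt (chartAt ℂ z ∘ c) a s t) :
    HasDerivWithinAt (chartAt ℂ z' ∘ c) (chartChange z z' (c t) * a) s t := by
  have h1 := (hasDerivAt_chart_transition hz hz').comp_hasDerivWithinAt_of_eq t h rfl
  refine h1.congr_of_eventuallyEq ?_ ?_
  · filter_upwards [hc ((chartAt ℂ z).open_source.mem_nhds hz)] with u hu
    simp [(chartAt ℂ z).left_inv hu]
  · simp [(chartAt ℂ z).left_inv hz]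

theorem chartChange_ne_zero {z z' x : T} (hx : x ∈ (chartAt ℂ z).source)
    (hx' : x ∈ (chartAt ℂ z').source) : chartChange z z' x ≠ 0 := by
  have h1 := hasDerivAt_chart_transition hx hx'
  have h2 := hasDerivAt_chart_transition hx' hx
  have h3 : HasDerivAt ((chartAt ℂ z ∘ (chartAt ℂ z').symm) ∘
      (chartAt ℂ z' ∘ (chartAt ℂ z).symm)) (chartChange z' z x * chartChange z z' x)
      (chartAt ℂ z x) := by
    refine HasDerivAt.comp_of_eq _ h2 h1 ?_
    simp [(chartAt ℂ z).left_inv hx]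
  have h4 : ((chartAt ℂ z ∘ (chartAt ℂ z').symm) ∘
      (chartAt ℂ z' ∘ (chartAt ℂ z).symm)) =ᶠ[𝓝 (chartAt ℂ z x)] id := by
    have hmem : chartAt ℂ z x ∈ ((chartAt ℂ z).symm ≫ₕ chartAt ℂ z').source := by
      simp [(chartAt ℂ z).map_source hx, (chartAt ℂ z).left_inv hx, hx']
    filter_upwards [((chartAt ℂ z).symm ≫ₕ chartAt ℂ z').open_source.mem_nhds hmem] with y hy
    simp at hy
    simp [(chartAt ℂ z').left_inv hy.2, (chartAt ℂ z).right_inv hy.1]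
  have h5 := (h3.congr_of_eventuallyEq h4.symm).unique (hasDerivAt_id _)
  intro h0
  simp [h0] at h5

theorem isManifold_real : IsManifold 𝓘(ℝ, ℂ) 1 T := by
  refine isManifold_of_contDiffOn _ _ _ fun e e' he he' => ?_
  have h := HasGroupoid.compatible (G := contDiffGroupoid ω 𝓘(ℂ)) he he'
  have h2 := contMDiffOn_of_mem_contDiffGroupoid h
  rw [contMDiffOn_iff_contDiffOn] at h2
  simpa using (h2.of_le (m := 1) le_top).restrict_scalars ℝ

/-- At time `u` the curve `η` crosses `c`, at the point `c t`, transversally from right to left. -/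
structure IsPositiveCrossing (c : ℝ → T) (t : ℝ) (η : ℝ → T) (u : ℝ) : Prop where
  meets : η u = c t
  continuousAt_left : ContinuousAt c t
  continuousAt_right : ContinuousAt η u
  exists_deriv : ∃ z, c t ∈ (chartAt ℂ z).source ∧ ∃ a b : ℂ,
    HasDerivAt (chartAt ℂ z ∘ c) a t ∧ HasDerivAt (chartAt ℂ z ∘ η) b u ∧ 0 < (conj a * b).im

/-- A holomorphic change of charts multiplies both velocities by the same `D ≠ 0`, so `conj a * b`
is multiplied by `|D|² > 0`. -/
theorem IsPositiveCrossing.exists_deriv_chart {c η : ℝ → T} {t u : ℝ}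
    (h : IsPositiveCrossing c t η u) {z : T} (hz : c t ∈ (chartAt ℂ z).source) :
    ∃ a b : ℂ, HasDerivAt (chartAt ℂ z ∘ c) a t ∧ HasDerivAt (chartAt ℂ z ∘ η) b u ∧
      0 < (conj a * b).im := by
  obtain ⟨z', hz', a, b, ha, hb, hab⟩ := h.exists_deriv
  rw [← hasDerivWithinAt_univ] at ha hb
  refine ⟨_, _, (hasDerivWithinAt_chart_comp h.continuousAt_left.continuousWithinAt hz' hz
    ha).hasDerivAt univ_mem, (hasDerivWithinAt_chart_comp
    h.continuousAt_right.continuousWithinAt (h.meets ▸ hz') (h.meets ▸ hz) hb).hasDerivAt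
    univ_mem, ?_⟩
  rw [h.meets]
  have hD := chartChange_ne_zero hz' hz
  have : conj (chartChange z' z (c t) * a) * (chartChange z' z (c t) * b) =
      (Complex.normSq (chartChange z' z (c t)) : ℂ) * (conj a * b) := by
    rw [map_mul, Complex.normSq_eq_conj_mul_self]; ring
  rw [this, Complex.im_ofReal_mul]
  exact mul_pos (Complex.normSq_pos.2 hD) hab

end Charts

/-! ### Edges of a cut system: parametrizations, tangents, local structure. -/

namespace ArcSystem

section Edges

variable {S T G : Type*} [Group G] [MulAction G S] {p : S → T} [TopologicalSpace T]
  [ChartedSpace ℂ T] {E : ArcSystem T}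

/-- The parameter on the underlying edge of the parameter `t` on an oriented edge. -/
def edgeParam (b : Bool) (t : ℝ) : ℝ := if b then 1 - t else t

theorem path_eq (E : ArcSystem T) (d : E.OrientedEdge) :
    E.path d = E.arc d.1 ∘ edgeParam d.2 := by
  funext t
  rcases d with ⟨e, _ | _⟩ <;> simp [path, edgeParam]

theorem edgeParam_edgeParam (b : Bool) (t : ℝ) : edgeParam b (edgeParam b t) = t := by
  cases b <;> simp [edgeParam]

theorem edgeParam_mem_Icc {b : Bool} {t : ℝ} (ht : t ∈ Icc (0 : ℝ) 1) :
    edgeParam b t ∈ Icc (0 : ℝ) 1 := by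
  cases b <;> simp_all [edgeParam]

theorem edgeParam_mem_Ioo {b : Bool} {t : ℝ} (ht : t ∈ Ioo (0 : ℝ) 1) :
    edgeParam b t ∈ Ioo (0 : ℝ) 1 := by
  cases b <;> simp_all [edgeParam]

theorem hasDerivAt_edgeParam (b : Bool) (t : ℝ) :
    HasDerivAt (edgeParam b) (if b then -1 else 1) t := by
  cases b
  · exact (hasDerivAt_id' t).congr_deriv (by simp)
  · exact ((hasDerivAt_id' t).const_sub 1).congr_deriv (by simp)

theorem contDiff_edgeParam (b : Bool) : ContDiff ℝ 1 (edgeParam b) := by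
  cases b
  · exact contDiff_id
  · exact contDiff_const.sub contDiff_id

theorem continuous_edgeParam (b : Bool) : Continuous (edgeParam b) :=
  (contDiff_edgeParam b).continuous

theorem IsCutSystem.continuousOn_arc (hE : E.IsCutSystem G p) (e : Fin E.numEdges) :
    ContinuousOn (E.arc e) (Icc 0 1) := (hE.smooth e).continuousOn

theorem IsCutSystem.continuousOn_path (hE : E.IsCutSystem G p) (d : E.OrientedEdge) :
    ContinuousOn (E.path d) (Icc 0 1) := by
  rw [path_eq]
  exact (hE.continuousOn_arc d.1).comp (continuous_edgeParam d.2).continuousOn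
    fun t ht => edgeParam_mem_Icc ht

theorem IsCutSystem.continuousAt_path (hE : E.IsCutSystem G p) (d : E.OrientedEdge) {t : ℝ}
    (ht : t ∈ Ioo (0 : ℝ) 1) : ContinuousAt (E.path d) t :=
  (hE.continuousOn_path d).continuousAt (Icc_mem_nhds ht.1 ht.2)

theorem IsCutSystem.path_notMem_vertices (hE : E.IsCutSystem G p) (d : E.OrientedEdge) {t : ℝ}
    (ht : t ∈ Ioo (0 : ℝ) 1) : E.path d t ∉ E.vertices := by
  rw [path_eq]
  exact hE.interior d.1 _ (edgeParam_mem_Ioo ht)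

theorem IsCutSystem.isClosed_carrier [T2Space T] (hE : E.IsCutSystem G p) :
    IsClosed E.carrier :=
  E.vertices.finite_toSet.isClosed.union (isClosed_iUnion_of_finite fun e =>
    (isCompact_Icc.image_of_continuousOn (hE.continuousOn_arc e)).isClosed)

theorem IsCutSystem.not_isConePoint (hE : E.IsCutSystem G p) {z : T} (hz : z ∉ E.vertices) :
    ¬ IsConePoint G p z := fun h => hz (hE.cone_mem z h)

theorem IsCutSystem.not_isConePoint_of_mem_compl (hE : E.IsCutSystem G p) {z : T}
    (hz : z ∈ E.carrierᶜ) : ¬ IsConePoint G p z :=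
  hE.not_isConePoint fun h => hz (Or.inl h)

variable [IsManifold 𝓘(ℂ) ω T]

theorem IsCutSystem.contDiffWithinAt_arc (hE : E.IsCutSystem G p) (e : Fin E.numEdges)
    {t : ℝ} (ht : t ∈ Icc (0 : ℝ) 1) {z : T} (hz : E.arc e t ∈ (chartAt ℂ z).source) :
    ContDiffWithinAt ℝ 1 (chartAt ℂ z ∘ E.arc e) (Icc 0 1) t := by
  have := isManifold_real (T := T)
  have h := ((contMDiffWithinAt_iff_of_mem_source (x := t) (y := z) (by simp) hz).1
    (hE.smooth e t ht)).2
  simp only [extChartAt, OpenPartialHomeomorph.extend] at h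
  simp at h
  exact h

theorem IsCutSystem.contDiffWithinAt_path (hE : E.IsCutSystem G p) (d : E.OrientedEdge)
    {t : ℝ} (ht : t ∈ Icc (0 : ℝ) 1) {z : T} (hz : E.path d t ∈ (chartAt ℂ z).source) :
    ContDiffWithinAt ℝ 1 (chartAt ℂ z ∘ E.path d) (Icc 0 1) t := by
  rw [path_eq] at hz ⊢
  exact ((hE.contDiffWithinAt_arc d.1 (edgeParam_mem_Icc (b := d.2) ht) hz).comp t
    (contDiff_edgeParam d.2).contDiffWithinAt fun s hs => edgeParam_mem_Icc hs)

theorem IsCutSystem.exists_hasDerivWithinAt_path (hE : E.IsCutSystem G p) (d : E.OrientedEdge)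
    {t : ℝ} (ht : t ∈ Icc (0 : ℝ) 1) {z : T} (hz : E.path d t ∈ (chartAt ℂ z).source) :
    ∃ a : ℂ, a ≠ 0 ∧ HasDerivWithinAt (chartAt ℂ z ∘ E.path d) a (Icc 0 1) t := by
  have ht' := edgeParam_mem_Icc (b := d.2) ht
  set z₀ := E.arc d.1 (edgeParam d.2 t) with hz₀
  have h1 : HasDerivWithinAt (chartAt ℂ z₀ ∘ E.arc d.1) (velocity (E.arc d.1) (edgeParam d.2 t))
      (Icc 0 1) (edgeParam d.2 t) :=
    ((hE.contDiffWithinAt_arc d.1 ht' (mem_chart_source ℂ z₀)).differentiableWithinAt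
      one_ne_zero).hasDerivWithinAt
  have h2 := HasDerivWithinAt.scomp t h1 (hasDerivAt_edgeParam d.2 t).hasDerivWithinAt
    (s := Icc 0 1) fun s hs => edgeParam_mem_Icc hs
  have hz' : E.path d t ∈ (chartAt ℂ z₀).source := by
    rw [path_eq]; exact mem_chart_source ℂ z₀
  have h3 : HasDerivWithinAt (chartAt ℂ z₀ ∘ E.path d)
      ((if d.2 then (-1 : ℝ) else 1) • velocity (E.arc d.1) (edgeParam d.2 t)) (Icc 0 1) t := by
    rw [path_eq]; exact h2
  refine ⟨_, ?_, hasDerivWithinAt_chart_comp (hE.continuousOn_path d t ht) hz' hz h3⟩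
  refine mul_ne_zero (chartChange_ne_zero hz' hz) (smul_ne_zero ?_ (hE.regular d.1 _ ht'))
  split_ifs <;> norm_num

theorem IsCutSystem.hasDerivWithinAt_direction (hE : E.IsCutSystem G p) (d : E.OrientedEdge) :
    HasDerivWithinAt (chartAt ℂ (E.start d) ∘ E.path d) (E.direction d) (Icc 0 1) 0 := 
  ((hE.contDiffWithinAt_path d (left_mem_Icc.2 zero_le_one)
    (mem_chart_source ℂ (E.start d))).differentiableWithinAt one_ne_zero).hasDerivWithinAt

theorem IsCutSystem.direction_ne_zero (hE : E.IsCutSystem G p) (d : E.OrientedEdge) :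
    E.direction d ≠ 0 := by
  obtain ⟨a, ha, h⟩ := hE.exists_hasDerivWithinAt_path d (left_mem_Icc.2 zero_le_one)
    (z := E.start d) (mem_chart_source ℂ (E.start d))
  have := (uniqueDiffOn_Icc (zero_lt_one (α := ℝ)) 0 (left_mem_Icc.2 zero_le_one)).eq_deriv _ h
    (hE.hasDerivWithinAt_direction d)
  exact this ▸ ha

/-- Near an interior point of an edge the graph consists of that edge only. -/
theorem IsCutSystem.eventually_mem_carrier_imp [T2Space T] (hE : E.IsCutSystem G p)
    (d : E.OrientedEdge) {t₀ : ℝ} (ht₀ : t₀ ∈ Ioo (0 : ℝ) 1) {N : Set ℝ} (hN : N ∈ 𝓝 t₀) :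
    ∀ᶠ x in 𝓝 (E.path d t₀), x ∈ E.carrier → ∃ t ∈ N, E.path d t = x := by
  have h1 : ∀ᶠ x in 𝓝 (E.path d t₀), x ∉ (E.vertices : Set T) :=
    E.vertices.finite_toSet.isClosed.isOpen_compl.mem_nhds (hE.path_notMem_vertices d ht₀)
  -- Compactness of the edge reduces this to one parameter at a time. The membership `t ∈ Icc 0 1`
  -- is repeated because the neighbourhoods in the product with `ℝ` also contain parameters outside
  -- the interval.
  have h2 : ∀ e, ∀ᶠ x in 𝓝 (E.path d t₀), ∀ t ∈ Icc (0 : ℝ) 1,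
      t ∈ Icc (0 : ℝ) 1 → E.arc e t = x → ∃ t ∈ N, E.path d t = x := by
    intro e
    refine isCompact_Icc.eventually_forall_of_forall_eventually fun t ht => ?_
    by_cases hne : E.arc e t = E.path d t₀
    · have ht' : t ∈ Ioo (0 : ℝ) 1 := by
        have hv := hE.path_notMem_vertices d ht₀
        refine ⟨lt_of_le_of_ne ht.1 ?_, lt_of_le_of_ne ht.2 ?_⟩
        · rintro rfl; exact hv (hne ▸ (hE.endpoints e).1)
        · rintro rfl; exact hv (hne ▸ (hE.endpoints e).2)
      rw [path_eq] at hne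
      obtain ⟨rfl, rfl⟩ := hE.embedded _ _ t ht' _ (edgeParam_mem_Ioo ht₀) hne
      have hcont : Tendsto (fun q : T × ℝ => edgeParam d.2 q.2)
          (𝓝 (E.path d t₀, edgeParam d.2 t₀)) (𝓝 t₀) := by
        have : Continuous fun q : T × ℝ => edgeParam d.2 q.2 :=
          (continuous_edgeParam d.2).comp continuous_snd
        have h := this.tendsto (E.path d t₀, edgeParam d.2 t₀)
        rwa [edgeParam_edgeParam] at h
      filter_upwards [hcont hN] with q hq _ hqx
      refine ⟨_, hq, ?_⟩
      rw [path_eq, Function.comp_apply, edgeParam_edgeParam, hqx]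
    · obtain ⟨A, B, hA, hB, htA, hxB, hAB⟩ := t2_separation hne
      have h3 := hE.continuousOn_arc e t ht (hA.mem_nhds htA)
      rw [mem_map, mem_nhdsWithin_iff_exists_mem_nhds_inter] at h3
      obtain ⟨M, hM, hMA⟩ := h3
      filter_upwards [prod_mem_nhds (hB.mem_nhds hxB) hM] with q hq hq1 hqx
      exact absurd hq.1 (disjoint_left.1 hAB (hqx ▸ hMA ⟨hq.2, hq1⟩))
  filter_upwards [h1, eventually_all.2 h2] with x hx1 hx2 hx
  rcases hx with hx | hx
  · exact absurd hx hx1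
  · obtain ⟨e, t, ht, hxt⟩ := mem_iUnion.1 hx
    exact hx2 e t ht ht hxt

end Edges

end ArcSystem

/-! ### Normal coordinates along a regular plane curve. -/

section Straightening

/-- Normal coordinates along the plane curve `c`: the point at signed distance `ζ.im` to the left
of `c ζ.re`, measured along the fixed direction `I * a`. -/
noncomputable def normalCoord (c : ℝ → ℂ) (a : ℂ) (ζ : ℂ) : ℂ :=
  c ζ.re + ζ.im * (Complex.I * a)

theorem normalCoord_ofReal (c : ℝ → ℂ) (a : ℂ) (t : ℝ) : normalCoord c a t = c t := by
  simp [normalCoord]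

theorem hasFDerivAt_normalCoord {c : ℝ → ℂ} (a : ℂ) {b : ℂ} {ζ : ℂ} (h : HasDerivAt c b ζ.re) :
    HasFDerivAt (normalCoord c a) (Complex.reCLM.smulRight b +
      Complex.imCLM.smulRight (Complex.I * a)) ζ := by
  have h1 : HasFDerivAt (fun ζ : ℂ => c ζ.re) (Complex.reCLM.smulRight b) ζ := by
    have h' : HasFDerivAt c (ContinuousLinearMap.toSpanSingleton ℝ b) (Complex.reCLM ζ) :=
      h.hasFDerivAt
    refine (h'.comp ζ Complex.reCLM.hasFDerivAt).congr_fderiv ?_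
    ext w
    simp
  have h2 : HasFDerivAt (fun ζ : ℂ => (ζ.im : ℂ) * (Complex.I * a))
      (Complex.imCLM.smulRight (Complex.I * a)) ζ := by
    have := (Complex.imCLM.smulRight (Complex.I * a)).hasFDerivAt (x := ζ)
    convert this using 1
    ext ζ
    simp
  exact h1.add h2

/-- The derivative at `t₀` is multiplication by the complex number `a`, hence invertible, and the
inverse function theorem applies. -/
theorem exists_openPartialHomeomorph_normalCoord {c : ℝ → ℂ} {t₀ : ℝ} {a : ℂ} (ha : a ≠ 0)
    (hc : ContDiffAt ℝ 1 c t₀) (hd : HasDerivAt c a t₀) :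
    ∃ g : OpenPartialHomeomorph ℂ ℂ, (g : ℂ → ℂ) = normalCoord c a ∧ (t₀ : ℂ) ∈ g.source ∧
      ContDiffAt ℝ 1 g.symm (c t₀) := by
  have hf : ContDiffAt ℝ 1 (normalCoord c a) (t₀ : ℂ) := by
    have h1 : ContDiffAt ℝ 1 (fun ζ : ℂ => c ζ.re) (t₀ : ℂ) :=
      ContDiffAt.comp (t₀ : ℂ) (by simpa using hc) Complex.reCLM.contDiff.contDiffAt
    have h2 : ContDiffAt ℝ 1 (fun ζ : ℂ => (ζ.im : ℂ) * (Complex.I * a)) (t₀ : ℂ) :=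
      ((Complex.ofRealCLM.contDiff.comp Complex.imCLM.contDiff).mul contDiff_const).contDiffAt
    exact h1.add h2
  have hf' : HasFDerivAt (normalCoord c a) ((ContinuousLinearEquiv.restrictScalars ℝ
      (ContinuousLinearEquiv.unitsEquivAut ℂ (Units.mk0 a ha)) : ℂ ≃L[ℝ] ℂ) : ℂ →L[ℝ] ℂ)
      (t₀ : ℂ) := by
    refine (hasFDerivAt_normalCoord a (ζ := (t₀ : ℂ)) (by simpa using hd)).congr_fderiv ?_
    ext w
    have h : (w.re : ℂ) * a + w.im * (Complex.I * a) = w * a := by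
      conv_rhs => rw [← Complex.re_add_im w]
      ring
    simpa using h
  refine ⟨hf.toOpenPartialHomeomorph _ hf' one_ne_zero, rfl,
    hf.mem_toOpenPartialHomeomorph_source hf' one_ne_zero, ?_⟩
  have := hf.to_localInverse hf' one_ne_zero
  rw [normalCoord_ofReal] at this
  exact this

end Straightening

/-! ### Straightening the graph near an interior point of an edge. -/

namespace ArcSystem

section Crossing

variable {S T G : Type*} [Group G] [MulAction G S] {p : S → T} [TopologicalSpace T] [T2Space T]
  [ChartedSpace ℂ T] [IsManifold 𝓘(ℂ) ω T] {E : ArcSystem T}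

/-- A neighbourhood of an interior point of an edge, with coordinates in which the graph is the
real line. -/
theorem IsCutSystem.exists_straightening (hE : E.IsCutSystem G p) (d : E.OrientedEdge) {t₀ : ℝ}
    (ht₀ : t₀ ∈ Ioo (0 : ℝ) 1) :
    ∃ ε > 0, ∃ F : ℂ → T, ContinuousOn F (Metric.ball (t₀ : ℂ) ε) ∧
      (∀ ζ ∈ Metric.ball (t₀ : ℂ) ε, ζ.im ≠ 0 → F ζ ∉ E.carrier) ∧
      ∀ t : ℝ, (t : ℂ) ∈ Metric.ball (t₀ : ℂ) ε → t ∈ Ioo (0 : ℝ) 1 ∧ F t = E.path d t ∧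
        IsPositiveCrossing (E.path d) t (fun u : ℝ => F (t + u * Complex.I)) 0 ∧
        ∀ η u, IsPositiveCrossing (E.path d) t η u → ∃ κ : ℝ → ℂ, ContinuousAt κ u ∧ κ u = t ∧
          (∀ᶠ s in 𝓝 u, F (κ s) = η s) ∧ (∀ᶠ s in 𝓝[<] u, (κ s).im < 0) ∧
          ∀ᶠ s in 𝓝[>] u, 0 < (κ s).im := by
  set z := E.path d t₀ with hz
  set φ := chartAt ℂ z with hφ
  set c : ℝ → ℂ := φ ∘ E.path d with hc
  have hzs : z ∈ φ.source := mem_chart_source ℂ z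
  have hIcc : Icc (0 : ℝ) 1 ∈ 𝓝 t₀ := Icc_mem_nhds ht₀.1 ht₀.2
  have hcd : ContDiffAt ℝ 1 c t₀ :=
    (hE.contDiffWithinAt_path d (Ioo_subset_Icc_self ht₀) hzs).contDiffAt hIcc
  obtain ⟨a, ha, hda⟩ := hE.exists_hasDerivWithinAt_path d (Ioo_subset_Icc_self ht₀) hzs
  replace hda : HasDerivAt c a t₀ := hda.hasDerivAt hIcc
  obtain ⟨g, hg, hgs, hgd⟩ := exists_openPartialHomeomorph_normalCoord ha hcd hda
  set F : ℂ → T := fun ζ => φ.symm (normalCoord c a ζ) with hF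
  have hpc := hE.continuousAt_path d ht₀
  -- The last condition says that the tangent at `t` makes an acute angle with `a`. Equivalently,
  -- the fixed normal `I * a` still points to the left of the curve at `t`, not only at `t₀`.
  have hN : ∀ᶠ t : ℝ in 𝓝 t₀, t ∈ Ioo (0 : ℝ) 1 ∧ E.path d t ∈ φ.source ∧ (t : ℂ) ∈ g.source ∧
      ContDiffAt ℝ 1 c t ∧ ContDiffAt ℝ 1 g.symm (c t) ∧ 0 < (conj (deriv c t) * a).re := by
    refine Eventually.and (Ioo_mem_nhds ht₀.1 ht₀.2) (Eventually.and
      (hpc (φ.open_source.mem_nhds hzs)) (Eventually.and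
      (Complex.continuous_ofReal.continuousAt (g.open_source.mem_nhds hgs))
      ((hcd.eventually (by simp)).and
      ((hcd.continuousAt.eventually (hgd.eventually (by simp))).and ?_))))
    have h1 : ContinuousAt (deriv c) t₀ := by
      have := (hcd.fderiv_right (m := 0) (by simp)).continuousAt
      have h2 : ContinuousAt (fun t => fderiv ℝ c t 1) t₀ := this.clm_apply continuousAt_const
      exact h2
    have h2 : ContinuousAt (fun t => (conj (deriv c t) * a).re) t₀ :=
      Complex.continuous_re.continuousAt.comp
        ((Complex.continuous_conj.continuousAt.comp h1).mul continuousAt_const)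
    refine h2.eventually (lt_mem_nhds ?_)
    show 0 < (conj (deriv c t₀) * a).re
    rw [hda.deriv, ← Complex.normSq_eq_conj_mul_self]
    simpa using ha
  have hgt : ContinuousAt (normalCoord c a) (t₀ : ℂ) := hg ▸ g.continuousAt hgs
  have hnt : normalCoord c a t₀ = φ z := normalCoord_ofReal c a t₀
  have hFt : F t₀ = z := by simp [hF, hnt, φ.left_inv hzs]
  have hFc : ContinuousAt F (t₀ : ℂ) :=
    ContinuousAt.comp (by rw [hnt]; exact φ.continuousAt_symm (φ.map_source hzs)) hgt
  have hM : ∀ᶠ ζ : ℂ in 𝓝 (t₀ : ℂ), ζ ∈ g.source ∧ normalCoord c a ζ ∈ φ.target ∧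
      (F ζ ∈ E.carrier → ∃ t : ℝ, (t ∈ Ioo (0 : ℝ) 1 ∧ E.path d t ∈ φ.source ∧
        (t : ℂ) ∈ g.source ∧ ContDiffAt ℝ 1 c t ∧ ContDiffAt ℝ 1 g.symm (c t) ∧
        0 < (conj (deriv c t) * a).re) ∧ E.path d t = F ζ) := by
    refine Eventually.and (g.open_source.mem_nhds hgs) (Eventually.and (hgt
      (φ.open_target.mem_nhds (hnt ▸ φ.map_source hzs))) ?_)
    have hFz : Tendsto F (𝓝 (t₀ : ℂ)) (𝓝 z) := by
      have h : Tendsto F (𝓝 (t₀ : ℂ)) (𝓝 (F t₀)) := hFc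
      rwa [hFt] at h
    -- The parameters allowed are those in `hN`, so a nearby point of the graph has a real preimage
    -- in `g.source`. Injectivity of `g` there then excludes `ζ.im ≠ 0`.
    exact hFz.eventually (hE.eventually_mem_carrier_imp d ht₀ hN)
  obtain ⟨ε₁, hε₁, h1⟩ := Metric.eventually_nhds_iff_ball.1 hN
  obtain ⟨ε₂, hε₂, h2⟩ := Metric.eventually_nhds_iff_ball.1 hM
  refine ⟨min ε₁ ε₂, lt_min hε₁ hε₂, F, ?_, ?_, ?_⟩
  · intro ζ hζ
    obtain ⟨hζg, hζφ, -⟩ := h2 ζ (Metric.ball_subset_ball (min_le_right _ _) hζ)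
    exact (ContinuousAt.comp (φ.continuousAt_symm hζφ)
      (hg ▸ g.continuousAt hζg)).continuousWithinAt
  · intro ζ hζ him hcar
    obtain ⟨hζg, hζφ, h3⟩ := h2 ζ (Metric.ball_subset_ball (min_le_right _ _) hζ)
    obtain ⟨t, ⟨-, hts, htg, -⟩, htF⟩ := h3 hcar
    have h4 : normalCoord c a t = normalCoord c a ζ := by
      rw [normalCoord_ofReal, hc, Function.comp_apply, htF, hF]
      exact φ.right_inv hζφ
    rw [← hg] at h4
    have := g.injOn htg hζg h4
    rw [← this] at him
    simp at him
  · intro t ht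
    have ht1 : t ∈ Metric.ball t₀ ε₁ := by
      have := Metric.ball_subset_ball (min_le_left ε₁ ε₂) ht
      rw [Metric.mem_ball, Complex.dist_eq, ← Complex.ofReal_sub, Complex.norm_real] at this
      exact this
    obtain ⟨htI, hts, htg, htcd, htgd, htpos⟩ := h1 t ht1
    obtain ⟨-, htφ, -⟩ := h2 t (Metric.ball_subset_ball (min_le_right _ _) ht)
    have hFt : F t = E.path d t := by
      simp [hF, normalCoord_ofReal, hc, φ.left_inv hts]
    have hdt : HasDerivAt c (deriv c t) t := (htcd.differentiableAt one_ne_zero).hasDerivAt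
    refine ⟨htI, hFt, ?_, ?_⟩
    · have hline : Tendsto (fun u : ℝ => (t + u * Complex.I : ℂ)) (𝓝 0) (𝓝 (t : ℂ)) := by
        have : Continuous fun u : ℝ => (t + u * Complex.I : ℂ) := by fun_prop
        simpa using this.tendsto 0
      refine ⟨by simpa using hFt, hE.continuousAt_path d htI, ?_, z, hts, deriv c t,
        Complex.I * a, hdt, ?_, ?_⟩
      · have hFc : ContinuousAt F (t : ℂ) := ContinuousAt.comp (φ.continuousAt_symm htφ)
          (hg ▸ g.continuousAt htg)
        refine ContinuousAt.comp (g := F) (by simpa using hFc) ?_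
        rw [ContinuousAt]
        simpa using hline
      · have h5 : HasDerivAt (fun u : ℝ => c t + (u : ℂ) * (Complex.I * a)) (Complex.I * a) 0 := by
          simpa using ((hasDerivAt_id' (0 : ℝ)).ofReal_comp.mul_const (Complex.I * a)).const_add
            (c t)
        refine h5.congr_of_eventuallyEq ?_
        have hgc : ContinuousAt (normalCoord c a) (t : ℂ) := hg ▸ g.continuousAt htg
        filter_upwards [hline (hgc (φ.open_target.mem_nhds htφ))] with u hu
        have hu' : normalCoord c a (t + u * Complex.I) ∈ φ.target := hu
        simp only [Function.comp_apply, hF]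
        rw [← hφ, φ.right_inv hu']
        simp [normalCoord]
      · have : conj (deriv c t) * (Complex.I * a) = Complex.I * (conj (deriv c t) * a) := by ring
        rw [this, Complex.I_mul_im]
        exact htpos
    · intro η u hη
      obtain ⟨a', b, ha', hb, hab⟩ := hη.exists_deriv_chart hts
      have ha'' : a' = deriv c t := ha'.unique hdt
      subst ha''
      have hηs : η u ∈ φ.source := hη.meets ▸ hts
      have hgt : g t = c t := by rw [hg, normalCoord_ofReal]
      have hηc : φ (η u) = c t := by rw [hη.meets]; rfl
      have hctg : c t ∈ g.target := hgt ▸ g.map_source htg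
      have hφη : ContinuousAt (fun s => φ (η s)) u :=
        ContinuousAt.comp (φ.continuousAt hηs) hη.continuousAt_right
      have hκu : g.symm (φ (η u)) = t := by rw [hηc, ← hgt, g.left_inv htg]
      have hFκ : ∀ᶠ s in 𝓝 u, η s ∈ φ.source ∧ φ (η s) ∈ g.target :=
        Eventually.and (hη.continuousAt_right (φ.open_source.mem_nhds hηs))
          (hφη (g.open_target.mem_nhds (show φ (η u) ∈ g.target by rw [hηc]; exact hctg)))
      have hκd : HasDerivAt (fun s => g.symm (φ (η s))) (fderiv ℝ g.symm (c t) b) u := by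
        have h6 := (htgd.differentiableAt one_ne_zero).hasFDerivAt
        rw [← hηc] at h6 ⊢
        exact h6.comp_hasDerivAt u hb
      set k := fderiv ℝ g.symm (c t) b with hk
      -- The velocity `b` of `η` is split along the tangent and the fixed normal; `k` is the
      -- velocity of `η` in the straightened coordinates.
      have hkb : (k.re : ℂ) * deriv c t + k.im * (Complex.I * a) = b := by
        have h7 : HasFDerivAt (normalCoord c a) (Complex.reCLM.smulRight (deriv c t) +
            Complex.imCLM.smulRight (Complex.I * a)) (g.symm (φ (η u))) := by
          rw [hκu]
          exact hasFDerivAt_normalCoord a (by simpa using hdt)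
        have h8 := h7.comp_hasDerivAt u hκd
        have h9 : (normalCoord c a ∘ fun s => g.symm (φ (η s))) =ᶠ[𝓝 u] φ ∘ η := by
          filter_upwards [hFκ] with s hs
          simp only [Function.comp_apply]
          rw [← hg, g.right_inv hs.2]
        simpa using h8.unique (hb.congr_of_eventuallyEq h9)
      -- In `(conj c' * b).im` the tangential part drops out, since `conj c' * c'` is real; what
      -- remains is `k.im` times the positive number from `hN`.
      have hkim : 0 < k.im := by
        have h10 : conj (deriv c t) * b = (Complex.normSq (deriv c t) * k.re : ℝ) +
            (k.im : ℂ) * (Complex.I * (conj (deriv c t) * a)) := by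
          rw [← hkb]
          push_cast
          rw [Complex.normSq_eq_conj_mul_self]
          ring
        rw [h10, Complex.add_im, Complex.ofReal_im, zero_add, Complex.im_ofReal_mul,
          Complex.I_mul_im] at hab
        exact pos_of_mul_pos_left hab htpos.le
      refine ⟨fun s => g.symm (φ (η s)), hκd.continuousAt, hκu, ?_, ?_⟩
      · filter_upwards [hFκ] with s hs
        simp only [hF]
        rw [← hg, g.right_inv hs.2, φ.left_inv hs.1]
      · have h11 : HasDerivAt (fun s => (g.symm (φ (η s))).im) k.im u :=
          Complex.imCLM.hasFDerivAt.comp_hasDerivAt u hκd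
        have h12 := eventually_nhdsWithin_sign_eq_of_deriv_pos (h11.deriv ▸ hkim)
          (by simp only [hκu, Complex.ofReal_im])
        constructor
        · filter_upwards [nhdsWithin_le_nhds h12, self_mem_nhdsWithin] with s hs hsu
          rw [sign_neg (sub_neg.2 hsu), sign_eq_neg_one_iff] at hs
          exact hs
        · filter_upwards [nhdsWithin_le_nhds h12, self_mem_nhdsWithin] with s hs hsu
          rw [sign_pos (sub_pos.2 hsu), sign_eq_one_iff] at hs
          exact hs

end Crossing

end ArcSystem

/-! ### Labels of polygons and the crossing rule. -/

namespace ArcSystem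

section Labels

variable {S T G : Type*} [TopologicalSpace S] [T2Space S] [CompactSpace S] [TopologicalSpace T]
  [T2Space T] [ChartedSpace ℂ T] [Group G] [Finite G] [MulAction G S] [ContinuousConstSMul G S]
  {p : S → T} {E : ArcSystem T} {x₀ : S}

theorem IsCutSystem.exists_mem_smul_polygon (hE : E.IsCutSystem G p) (hp : IsOrbitMap G p)
    (hx₀ : p x₀ ∉ E.carrier) {x : S} (hx : p x ∉ E.carrier) :
    ∃ g : G, x ∈ g • E.polygon p x₀ :=
  hp.exists_mem_smul_sheet (fun _ hz => hE.not_isConePoint_of_mem_compl hz) hE.disc hx₀ hx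

theorem IsCutSystem.smul_polygon_inj (hE : E.IsCutSystem G p) (hp : IsOrbitMap G p)
    (hx₀ : p x₀ ∉ E.carrier) {x : S} {g g' : G} (hx : x ∈ g • E.polygon p x₀)
    (hx' : x ∈ g' • E.polygon p x₀) : g = g' :=
  hp.smul_sheet_inj hE.isClosed_carrier.isOpen_compl
    (fun _ hz => hE.not_isConePoint_of_mem_compl hz) hE.disc hx₀ hx hx'

theorem mem_one_smul_polygon (hx₀ : p x₀ ∉ E.carrier) : x₀ ∈ (1 : G) • E.polygon p x₀ := by
  rw [one_smul]
  exact mem_connectedComponentIn hx₀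

/-- A function that is continuous on a preconnected set, and there avoids the preimage of the
graph, stays in one open polygon. -/
theorem mem_smul_polygon_of_isPreconnected (hp : IsOrbitMap G p) {A : Type*} [TopologicalSpace A]
    {C : Set A} (hC : IsPreconnected C) {f : A → S} (hf : ContinuousOn f C)
    (hfC : ∀ a ∈ C, p (f a) ∉ E.carrier) {a b : A} (ha : a ∈ C) (hb : b ∈ C) {g : G}
    (hg : f a ∈ g • E.polygon p x₀) : f b ∈ g • E.polygon p x₀ :=
  hp.subset_smul_sheet (hC.image f hf) (by rintro _ ⟨y, hy, rfl⟩; exact hfC y hy)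
    (mem_image_of_mem f ha) hg (mem_image_of_mem f hb)

/-- Lifts of curves that cross the oriented edge `d` at the parameter `t` from right to left pass
from an open polygon with some label `g` to the one with label `g * ρ`. -/
def HasCrossing (E : ArcSystem T) (p : S → T) (x₀ : S) (d : E.OrientedEdge) (t : ℝ) (ρ : G) :
    Prop :=
  ∀ (η : ℝ → T) (u : ℝ) (η' : ℝ → S), IsPositiveCrossing (E.path d) t η u → ContinuousAt η' u →
    (∀ᶠ s in 𝓝 u, p (η' s) = η s) → ∃ g : G, (∀ᶠ s in 𝓝[<] u, η' s ∈ g • E.polygon p x₀) ∧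
      ∀ᶠ s in 𝓝[>] u, η' s ∈ (g * ρ) • E.polygon p x₀

variable [IsManifold 𝓘(ℂ) ω T]

/-- The straightened disc lifts to `S`, and its lower and upper halves lie in polygons `g` and `g'`.
Any other lift is a translate by some `k`, with labels `k * g` and `k * g'`, so the right quotient
`g⁻¹ * g'` is independent of the lift. The uniqueness clause is what later makes the quotient
locally constant. -/
theorem IsCutSystem.exists_eventually_hasCrossing (hE : E.IsCutSystem G p)
    (hp : IsOrbitMap G p) (hx₀ : p x₀ ∉ E.carrier) (d : E.OrientedEdge) {t₀ : ℝ}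
    (ht₀ : t₀ ∈ Ioo (0 : ℝ) 1) :
    ∃ ρ : G, ∀ᶠ t in 𝓝 t₀, E.HasCrossing p x₀ d t ρ ∧
      ∀ ρ', E.HasCrossing p x₀ d t ρ' → ρ' = ρ := by
  obtain ⟨ε, hε, F, hFc, hFcar, hF⟩ := hE.exists_straightening d ht₀
  have hcone : ∀ ζ ∈ Metric.ball (t₀ : ℂ) ε, ¬ IsConePoint G p (F ζ) := by
    intro ζ hζ
    by_cases him : ζ.im = 0
    · have hζr : ζ = (ζ.re : ℂ) := Complex.ext (by simp) (by simp [him])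
      rw [hζr] at hζ ⊢
      obtain ⟨ht, hFt, -⟩ := hF _ hζ
      rw [hFt]
      exact hE.not_isConePoint (hE.path_notMem_vertices d ht)
    · exact hE.not_isConePoint_of_mem_compl (hFcar ζ hζ him)
  obtain ⟨x, hx⟩ := hp.surjective (F t₀)
  obtain ⟨F', hF'c, -, hF'p⟩ := hp.exists_lift_of_convex (convex_ball (t₀ : ℂ) ε) hFc hcone
    (Metric.mem_ball_self hε) hx
  have hside : ∀ K : Set ℂ, Convex ℝ K → (∀ ζ ∈ K, ζ.im ≠ 0) →
      (Metric.ball (t₀ : ℂ) ε ∩ K).Nonempty →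
      ∃ g : G, ∀ ζ ∈ Metric.ball (t₀ : ℂ) ε ∩ K, F' ζ ∈ g • E.polygon p x₀ := by
    rintro K hK hK0 ⟨ζ₀, hζ₀⟩
    have hcar : ∀ ζ ∈ Metric.ball (t₀ : ℂ) ε ∩ K, p (F' ζ) ∉ E.carrier := fun ζ hζ => by
      rw [hF'p ζ hζ.1]
      exact hFcar ζ hζ.1 (hK0 ζ hζ.2)
    obtain ⟨g, hg⟩ := hE.exists_mem_smul_polygon hp hx₀ (hcar ζ₀ hζ₀)
    exact ⟨g, fun ζ hζ => mem_smul_polygon_of_isPreconnected hp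
      ((convex_ball _ _).inter hK).isPreconnected (hF'c.mono inter_subset_left) hcar hζ₀ hζ hg⟩
  have hmem : ∀ r : ℝ, |r| < ε → (t₀ + r * Complex.I : ℂ) ∈ Metric.ball (t₀ : ℂ) ε := by
    intro r hr
    simpa [Complex.dist_eq] using hr
  obtain ⟨g, hg⟩ := hside {ζ | ζ.im < 0} (convex_halfSpace_im_lt 0)
    (fun ζ hζ => ne_of_lt hζ) ⟨t₀ + (-(ε / 2) : ℝ) * Complex.I,
      hmem _ (by rw [abs_neg, abs_of_pos (half_pos hε)]; linarith), by simp [hε]⟩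
  obtain ⟨g', hg'⟩ := hside {ζ | 0 < ζ.im} (convex_halfSpace_im_gt 0)
    (fun ζ hζ => ne_of_gt hζ) ⟨t₀ + (ε / 2 : ℝ) * Complex.I,
      hmem _ (by rw [abs_of_pos (half_pos hε)]; linarith), by simp [hε]⟩
  refine ⟨g⁻¹ * g', ?_⟩
  filter_upwards [Complex.continuous_ofReal.continuousAt (Metric.ball_mem_nhds (t₀ : ℂ) hε)]
    with t ht
  replace ht : (t : ℂ) ∈ Metric.ball (t₀ : ℂ) ε := ht
  obtain ⟨htI, hFt, hcross, hκ⟩ := hF t ht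
  have hball : Metric.ball (t₀ : ℂ) ε ∈ 𝓝 (t : ℂ) := Metric.isOpen_ball.mem_nhds ht
  have hF't : ContinuousAt F' (t : ℂ) := hF'c.continuousAt hball
  refine ⟨?_, ?_⟩
  · intro η u η' hη hη'c hη'p
    obtain ⟨κ, hκc, hκu, hκF, hκneg, hκpos⟩ := hκ η u hη
    have hpu : p (F' t) = p (η' u) := by
      rw [hF'p t ht, hFt, hη'p.self_of_nhds, hη.meets]
    obtain ⟨k, hk⟩ := (hp.fibre _ _).1 hpu
    have hκball : ∀ᶠ s in 𝓝 u, κ s ∈ Metric.ball (t₀ : ℂ) ε :=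
      hκc (by rw [hκu]; exact hball)
    have heq : η' =ᶠ[𝓝 u] fun s => k • F' (κ s) := by
      have hcont : ContinuousAt (fun s => k • F' (κ s)) u :=
        ((continuous_const_smul k).continuousAt).comp
          (ContinuousAt.comp (g := F') (by rw [hκu]; exact hF't) hκc)
      refine hp.eventuallyEq_of_tendsto (x := η' u) ?_ hη'c ?_ ?_
      · rw [← hpu, hF'p t ht]
        exact hcone t ht
      · rw [ContinuousAt] at hcont
        simpa only [hκu, hk] using hcont
      · filter_upwards [hη'p, hκF, hκball] with s h1 h2 h3
        rw [h1, hp.map_smul, hF'p _ h3, h2]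
    refine ⟨k * g, ?_, ?_⟩
    · filter_upwards [nhdsWithin_le_nhds heq, nhdsWithin_le_nhds hκball, hκneg] with s h1 h2 h3
      rw [h1]
      exact mul_smul_mem_mul_smul (hg _ ⟨h2, h3⟩)
    · filter_upwards [nhdsWithin_le_nhds heq, nhdsWithin_le_nhds hκball, hκpos] with s h1 h2 h3
      rw [h1, mul_assoc, mul_inv_cancel_left]
      exact mul_smul_mem_mul_smul (hg' _ ⟨h2, h3⟩)
  -- Uniqueness is tested on the vertical segment through `t`, whose lift runs from the lower half
  -- disc to the upper one.
  · intro ρ' hρ'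
    have hline : Tendsto (fun u : ℝ => (t + u * Complex.I : ℂ)) (𝓝 0) (𝓝 (t : ℂ)) := by
      have : Continuous fun u : ℝ => (t + u * Complex.I : ℂ) := by fun_prop
      simpa using this.tendsto 0
    have hlball := hline hball
    obtain ⟨g₁, h1, h2⟩ := hρ' _ 0 (fun u : ℝ => F' (t + u * Complex.I)) hcross
      (by
        rw [ContinuousAt]
        simpa [Function.comp_def] using hF't.tendsto.comp hline)
      (by
        filter_upwards [hlball] with s hs
        exact hF'p _ hs)
    obtain ⟨s, hs, hsb, hs0⟩ := (h1.and (Eventually.and (nhdsWithin_le_nhds hlball)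
      (self_mem_nhdsWithin : ∀ᶠ s in 𝓝[<] (0 : ℝ), s ∈ Iio 0))).exists
    obtain ⟨s', hs', hsb', hs0'⟩ := (h2.and (Eventually.and (nhdsWithin_le_nhds hlball)
      (self_mem_nhdsWithin : ∀ᶠ s in 𝓝[>] (0 : ℝ), s ∈ Ioi 0))).exists
    have e1 : g₁ = g := hE.smul_polygon_inj hp hx₀ hs (hg _ ⟨hsb, by simpa using hs0⟩)
    have e2 : g₁ * ρ' = g' := hE.smul_polygon_inj hp hx₀ hs' (hg' _ ⟨hsb', by simpa using hs0'⟩)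
    rw [← e2, e1, inv_mul_cancel_left]

/-- A locally constant function on the connected open edge is constant. Thus the point at which a
crossover loop crosses the edge is irrelevant. -/
theorem IsCutSystem.exists_hasCrossing (hE : E.IsCutSystem G p) (hp : IsOrbitMap G p)
    (hx₀ : p x₀ ∉ E.carrier) (d : E.OrientedEdge) :
    ∃ ρ : G, ∀ t ∈ Ioo (0 : ℝ) 1, E.HasCrossing p x₀ d t ρ := by
  choose r hr using fun t : Ioo (0 : ℝ) 1 => hE.exists_eventually_hasCrossing hp hx₀ d t.2
  have : PreconnectedSpace (Ioo (0 : ℝ) 1) :=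
    isPreconnected_iff_preconnectedSpace.1 isPreconnected_Ioo
  have hloc : IsLocallyConstant r := by
    rw [IsLocallyConstant.iff_eventually_eq]
    intro t
    have h := continuous_subtype_val.continuousAt.eventually (hr t)
    filter_upwards [h] with s hs
    exact hs.2 _ (hr s).self_of_nhds.1
  refine ⟨r ⟨1 / 2, by norm_num⟩, fun t ht => ?_⟩
  rw [hloc.apply_eq_of_preconnectedSpace ⟨1 / 2, by norm_num⟩ ⟨t, ht⟩]
  exact (hr ⟨t, ht⟩).self_of_nhds.1

/-- `derivWithin` vanishes by default where there is no derivative, so a nonzero velocity implies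
differentiability. -/
theorem hasDerivAt_of_velocity_ne_zero {c : ℝ → T} {t : ℝ} (ht : t ∈ Ioo (0 : ℝ) 1)
    (h : velocity c t ≠ 0) : HasDerivAt (chartAt ℂ (c t) ∘ c) (velocity c t) t := by
  have hd : DifferentiableWithinAt ℝ (chartAt ℂ (c t) ∘ c) (Icc 0 1) t := by
    by_contra hd
    exact h (derivWithin_zero_of_not_differentiableWithinAt hd)
  exact hd.hasDerivWithinAt.hasDerivAt (Icc_mem_nhds ht.1 ht.2)

theorem IsCrossoverLoop.exists_isPositiveCrossing (hE : E.IsCutSystem G p)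
    {d : E.OrientedEdge} {z : T} {δ : Path z z} (hδ : E.IsCrossoverLoop d δ) :
    ∃ t ∈ Ioo (0 : ℝ) 1, ∃ s ∈ Ioo (0 : ℝ) 1, IsPositiveCrossing (E.path d) s δ.extend t ∧
      ∀ u ∈ Icc (0 : ℝ) 1, δ.extend u ∈ E.carrier → u = t := by
  obtain ⟨t, ht, s, hs, hst, hpos, huniq⟩ := hδ.crosses
  refine ⟨t, ht, s, hs, ⟨hst, hE.continuousAt_path d hs, δ.continuous_extend.continuousAt,
    E.path d s, mem_chart_source _ _, _, _, hasDerivAt_of_velocity_ne_zero hs ?_, ?_, hpos⟩, huniq⟩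
  · intro h
    simp [h] at hpos
  · rw [← hst]
    refine hasDerivAt_of_velocity_ne_zero ht ?_
    intro h
    simp [h] at hpos

/-- The only point of the loop on the graph is interior to an edge, so the loop avoids cone points
and lifts. Existence is what gives the `epsilon` in `monodromy` its meaning. -/
theorem IsCrossoverLoop.exists_lift_monodromy (hE : E.IsCutSystem G p) (hp : IsOrbitMap G p)
    {d : E.OrientedEdge} {δ : Path (p x₀) (p x₀)} (hδ : E.IsCrossoverLoop d δ) :
    ∃ Γ : Path x₀ (monodromy G p x₀ δ • x₀), ∀ t, p (Γ t) = δ t := by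
  obtain ⟨t₀, ht₀, s, hs, hcross, huniq⟩ := hδ.exists_isPositiveCrossing hE
  have hcone : ∀ t ∈ Icc (0 : ℝ) 1, ¬ IsConePoint G p (δ.extend t) := by
    intro t ht
    by_cases hcar : δ.extend t ∈ E.carrier
    · rw [huniq t ht hcar, hcross.meets]
      exact hE.not_isConePoint (hE.path_notMem_vertices d hs)
    · exact hE.not_isConePoint_of_mem_compl hcar
  obtain ⟨f, hfc, hf0, hfp⟩ := hp.exists_lift_of_convex (convex_Icc (0 : ℝ) 1)
    δ.continuous_extend.continuousOn hcone (left_mem_Icc.2 zero_le_one) (x := x₀) (by simp)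
  have hf1 : p x₀ = p (f 1) := by
    rw [hfp 1 (right_mem_Icc.2 zero_le_one)]
    simp
  obtain ⟨g, hg⟩ := (hp.fibre _ _).1 hf1
  have hex : ∃ g : G, ∃ Γ : Path x₀ (g • x₀), ∀ t, p (Γ t) = δ t :=
    ⟨g, ⟨⟨fun t => f t, hfc.comp_continuous continuous_subtype_val fun t => t.2⟩, by simpa using hf0,
      by simpa using hg.symm⟩, fun t => by simpa using hfp t t.2⟩
  exact Classical.epsilon_spec hex

/-- The lift from `x₀` stays in the polygon labelled `1` until the loop meets the edge and
afterwards in the one containing its end point, labelled `τ`. Comparison with the crossing rule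
gives `ρ = τ`. -/
theorem IsCrossoverLoop.hasCrossing_monodromy (hE : E.IsCutSystem G p) (hp : IsOrbitMap G p)
    (hx₀ : p x₀ ∉ E.carrier) {d : E.OrientedEdge} {δ : Path (p x₀) (p x₀)}
    (hδ : E.IsCrossoverLoop d δ) {t : ℝ} (ht : t ∈ Ioo (0 : ℝ) 1) :
    E.HasCrossing p x₀ d t (monodromy G p x₀ δ) := by
  obtain ⟨ρ, hρ⟩ := hE.exists_hasCrossing hp hx₀ d
  obtain ⟨t₀, ht₀, s, hs, hcross, huniq⟩ := hδ.exists_isPositiveCrossing hE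
  have hlift := hδ.exists_lift_monodromy hE hp
  set τ := monodromy G p x₀ δ
  obtain ⟨Γ, hΓ⟩ := hlift
  have hΓp : ∀ u, p (Γ.extend u) = δ.extend u := fun u =>
    hΓ (projIcc 0 1 zero_le_one u)
  obtain ⟨g, h1, h2⟩ := hρ s hs δ.extend t₀ Γ.extend hcross Γ.continuous_extend.continuousAt
    (Eventually.of_forall hΓp)
  have hleft : ∀ᶠ u in 𝓝[<] t₀, Γ.extend u ∈ (1 : G) • E.polygon p x₀ := by
    filter_upwards [Ioo_mem_nhdsLT ht₀.1] with u hu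
    refine mem_smul_polygon_of_isPreconnected hp (isPreconnected_Ico (a := 0) (b := t₀))
      Γ.continuous_extend.continuousOn ?_ (left_mem_Ico.2 ht₀.1) (Ioo_subset_Ico_self hu)
      (by simpa using mem_one_smul_polygon (G := G) hx₀)
    intro a ha hcar
    rw [hΓp] at hcar
    exact ha.2.ne (huniq a ⟨ha.1, ha.2.le.trans ht₀.2.le⟩ hcar)
  have hright : ∀ᶠ u in 𝓝[>] t₀, Γ.extend u ∈ τ • E.polygon p x₀ := by
    filter_upwards [Ioo_mem_nhdsGT ht₀.2] with u hu
    refine mem_smul_polygon_of_isPreconnected hp (isPreconnected_Ioc (a := t₀) (b := 1))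
      Γ.continuous_extend.continuousOn ?_ (right_mem_Ioc.2 ht₀.2) (Ioo_subset_Ioc_self hu)
      (by simpa using mul_smul_mem_mul_smul (g' := τ) (mem_one_smul_polygon (G := G) hx₀))
    intro a ha hcar
    rw [hΓp] at hcar
    exact ha.1.ne' (huniq a ⟨ht₀.1.le.trans ha.1.le, ha.2⟩ hcar)
  obtain ⟨u, hu, hu'⟩ := (h1.and hleft).exists
  obtain ⟨w, hw, hw'⟩ := (h2.and hright).exists
  have e1 := hE.smul_polygon_inj hp hx₀ hu hu'
  have e2 := hE.smul_polygon_inj hp hx₀ hw hw'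
  rw [e1, one_mul] at e2
  exact e2 ▸ hρ t ht

end Labels

end ArcSystem

/-! ### A regular curve germ in polar coordinates. -/

section PlaneGerm

theorem re_conj_mul_pos_of_norm_sub_one_lt {x y : ℂ} (hx : ‖x - 1‖ < 1 / 4)
    (hy : ‖y - 1‖ < 1 / 4) : 0 < (conj x * y).re := by
  have h1 := (abs_lt.1 ((Complex.abs_re_le_norm _).trans_lt hx))
  have h2 := (abs_lt.1 ((Complex.abs_im_le_norm _).trans_lt hx))
  have h3 := (abs_lt.1 ((Complex.abs_re_le_norm _).trans_lt hy))
  have h4 := (abs_lt.1 ((Complex.abs_im_le_norm _).trans_lt hy))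
  simp only [Complex.sub_re, Complex.sub_im, Complex.one_re, Complex.one_im, sub_zero] at h1 h2 h3 h4
  simp only [Complex.mul_re, Complex.conj_re, Complex.conj_im]
  nlinarith

/-- A plane curve that issues from the origin with nonzero velocity `a` and is `C¹` crosses each
small circle about the origin once, transversally, at an angle close to that of `a`. -/
theorem exists_logPolar_param {c c' : ℝ → ℂ} {a : ℂ} {b : ℝ} (ha : a ≠ 0) (hb : 0 < b)
    (hc0 : c 0 = 0) (hcc : ContinuousWithinAt c (Ici 0) 0)
    (h0 : Tendsto (fun t : ℝ => c t / (t * a)) (𝓝[>] 0) (𝓝 1))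
    (h1 : Tendsto (fun t => c' t / a) (𝓝[>] 0) (𝓝 1))
    (hd : ∀ᶠ t in 𝓝[>] 0, HasDerivAt c (c' t) t) :
    ∃ t₁ ∈ Ioo 0 b, ∃ (L : ℝ) (τ θ : ℝ → ℝ), Tendsto θ atBot (𝓝 (Complex.arg a)) ∧
      (∀ ρ < L, τ ρ ∈ Ioo 0 t₁ ∧ c (τ ρ) = Complex.exp (ρ + θ ρ * Complex.I) ∧
        HasDerivAt c (c' (τ ρ)) (τ ρ) ∧
        0 < (conj (c' (τ ρ)) * (Complex.I * c (τ ρ))).im) ∧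
      ∀ t ∈ Ioo 0 t₁, ∀ ρ < L, ‖c t‖ = Real.exp ρ → t = τ ρ := by
  have hball : Metric.ball (1 : ℂ) (1 / 4) ∈ 𝓝 (1 : ℂ) := Metric.ball_mem_nhds _ (by norm_num)
  have hgood : ∀ᶠ t in 𝓝[>] (0 : ℝ), ‖c t / (t * a) - 1‖ < 1 / 4 ∧ ‖c' t / a - 1‖ < 1 / 4 ∧
      HasDerivAt c (c' t) t := by
    filter_upwards [h0 hball, h1 hball, hd] with t ht ht' htd
    exact ⟨by simpa [Complex.dist_eq] using ht, by simpa [Complex.dist_eq] using ht', htd⟩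
  obtain ⟨ε, hε, hεgood⟩ := (mem_nhdsGT_iff_exists_Ioo_subset).1 hgood
  replace hε : 0 < ε := hε
  obtain ⟨t₁, ht₁, ht₁'⟩ : ∃ t₁, 0 < t₁ ∧ t₁ < min ε b := exists_between (lt_min hε hb)
  have hg : ∀ t ∈ Ioc 0 t₁, ‖c t / (t * a) - 1‖ < 1 / 4 ∧ ‖c' t / a - 1‖ < 1 / 4 ∧
      HasDerivAt c (c' t) t := fun t ht =>
    hεgood ⟨ht.1, ht.2.trans_lt (ht₁'.trans_le (min_le_left _ _))⟩
  -- This quantity is half the derivative of `|c|²`. Up to the factor `|a|² t` it pairs two numbers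
  -- close to `1`.
  have hpos : ∀ t ∈ Ioc 0 t₁, 0 < (conj (c' t) * c t).re := by
    intro t ht
    have h := re_conj_mul_pos_of_norm_sub_one_lt (hg t ht).2.1 (hg t ht).1
    have ht0 : (t : ℂ) ≠ 0 := Complex.ofReal_ne_zero.2 ht.1.ne'
    have : conj (c' t) * c t =
        (Complex.normSq a * t : ℝ) * (conj (c' t / a) * (c t / (t * a))) := by
      have ha' : conj a ≠ 0 := (map_ne_zero _).2 ha
      push_cast
      rw [Complex.normSq_eq_conj_mul_self, map_div₀]
      field_simp
    rw [this, Complex.re_ofReal_mul]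
    exact mul_pos (mul_pos (Complex.normSq_pos.2 ha) ht.1) h
  have hcont : ContinuousOn c (Icc 0 t₁) := by
    intro t ht
    rcases ht.1.eq_or_lt with rfl | h
    · exact hcc.mono Icc_subset_Ici_self
    · exact (hg t ⟨h, ht.2⟩).2.2.continuousAt.continuousWithinAt
  have hmono : StrictMonoOn (fun t => Complex.normSq (c t)) (Icc 0 t₁) := by
    refine strictMonoOn_of_deriv_pos (convex_Icc _ _)
      (Complex.continuous_normSq.comp_continuousOn hcont) ?_
    intro t ht
    rw [interior_Icc] at ht
    have hd := (hg t (Ioo_subset_Ioc_self ht)).2.2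
    have hre : HasDerivAt (fun t => (c t).re) (c' t).re t :=
      Complex.reCLM.hasFDerivAt.comp_hasDerivAt t hd
    have him : HasDerivAt (fun t => (c t).im) (c' t).im t :=
      Complex.imCLM.hasFDerivAt.comp_hasDerivAt t hd
    have hN : HasDerivAt (fun t => Complex.normSq (c t)) (2 * (conj (c' t) * c t).re) t := by
      have h := (hre.mul hre).add (him.mul him)
      refine h.congr_deriv ?_
      simp only [Complex.mul_re, Complex.conj_re, Complex.conj_im]
      ring
    rw [hN.deriv]
    have := hpos t (Ioo_subset_Ioc_self ht)
    linarith
  have hnorm : StrictMonoOn (fun t => ‖c t‖) (Icc 0 t₁) := by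
    intro s hs t ht hst
    have h := hmono hs ht hst
    simp only [Complex.normSq_eq_norm_sq] at h
    exact lt_of_pow_lt_pow_left₀ 2 (norm_nonneg _) h
  have hc1 : 0 < ‖c t₁‖ := by
    have := hnorm (left_mem_Icc.2 ht₁.le) (right_mem_Icc.2 ht₁.le) ht₁
    simpa [hc0] using this
  -- The distance to the origin increases on `[0, t₁]`, so each radius below `‖c t₁‖` is attained
  -- exactly once. For larger `ρ` the value is irrelevant.
  have hex : ∀ ρ : ℝ, ∃ t, ρ < Real.log ‖c t₁‖ → t ∈ Ioo 0 t₁ ∧ ‖c t‖ = Real.exp ρ := by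
    intro ρ
    by_cases hρ : ρ < Real.log ‖c t₁‖
    · have hmem : Real.exp ρ ∈ Ioo ‖c 0‖ ‖c t₁‖ := by
        refine ⟨by rw [hc0, norm_zero]; exact Real.exp_pos ρ, ?_⟩
        rwa [← Real.lt_log_iff_exp_lt hc1]
      obtain ⟨t, ht, h⟩ := intermediate_value_Ioo ht₁.le hcont.norm hmem
      exact ⟨t, fun _ => ⟨ht, h⟩⟩
    · exact ⟨0, fun h => absurd h hρ⟩
  choose τ hτ using hex
  have hτuniq : ∀ t ∈ Ioo 0 t₁, ∀ ρ < Real.log ‖c t₁‖, ‖c t‖ = Real.exp ρ → t = τ ρ := by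
    intro t ht ρ hρ h
    refine hnorm.injOn (Ioo_subset_Icc_self ht) (Ioo_subset_Icc_self (hτ ρ hρ).1) ?_
    simp only [h, (hτ ρ hρ).2]
  have hτ0 : Tendsto τ atBot (𝓝[>] 0) := by
    rw [tendsto_nhdsWithin_iff]
    refine ⟨?_, ?_⟩
    · rw [tendsto_order]
      refine ⟨fun x hx => ?_, fun x hx => ?_⟩
      · filter_upwards [Iio_mem_atBot (Real.log ‖c t₁‖)] with ρ hρ
        exact hx.trans (hτ ρ hρ).1.1
      · have hx' : min x t₁ ∈ Icc 0 t₁ := ⟨(lt_min hx ht₁).le, min_le_right _ _⟩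
        have hpos' : 0 < ‖c (min x t₁)‖ := by
          have := hnorm (left_mem_Icc.2 ht₁.le) hx' (lt_min hx ht₁)
          simpa [hc0] using this
        filter_upwards [Iio_mem_atBot (Real.log ‖c t₁‖),
          Iio_mem_atBot (Real.log ‖c (min x t₁)‖)] with ρ hρ hρ'
        have h := (hτ ρ hρ).2
        have h2 : ‖c (τ ρ)‖ < ‖c (min x t₁)‖ := by
          rw [h]
          exact (Real.lt_log_iff_exp_lt hpos').1 hρ'
        have := (hnorm.lt_iff_lt (Ioo_subset_Icc_self (hτ ρ hρ).1) hx').1 h2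
        exact this.trans_le (min_le_left _ _)
    · filter_upwards [Iio_mem_atBot (Real.log ‖c t₁‖)] with ρ hρ
      exact (hτ ρ hρ).1.1
  -- The angle is measured relative to `a`: `arg` is continuous at `1`, whereas `arg (c t)` could
  -- jump if `a` lay on the branch cut.
  refine ⟨t₁, ⟨ht₁, ht₁'.trans_le (min_le_right _ _)⟩, Real.log ‖c t₁‖, τ,
    fun ρ => Complex.arg a + Complex.arg (c (τ ρ) / a), ?_, ?_, hτuniq⟩
  · have harg : Tendsto (fun t : ℝ => Complex.arg (c t / (t * a))) (𝓝[>] 0) (𝓝 0) := by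
      have h := (Complex.continuousAt_arg Complex.one_mem_slitPlane).tendsto.comp h0
      rwa [Complex.arg_one] at h
    have h2 : Tendsto (fun ρ => Complex.arg (c (τ ρ) / a)) atBot (𝓝 0) := by
      refine (harg.comp hτ0).congr' ?_
      filter_upwards [Iio_mem_atBot (Real.log ‖c t₁‖)] with ρ hρ
      have ht := (hτ ρ hρ).1.1
      have : c (τ ρ) / (τ ρ * a) = ((τ ρ)⁻¹ : ℝ) * (c (τ ρ) / a) := by
        push_cast
        field_simp
      simp only [Function.comp_apply]
      rw [this, Complex.arg_real_mul _ (inv_pos.2 ht)]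
    simpa using h2.const_add (Complex.arg a)
  · intro ρ hρ
    obtain ⟨ht, hn⟩ := hτ ρ hρ
    refine ⟨ht, ?_, (hg _ (Ioo_subset_Ioc_self ht)).2.2, ?_⟩
    · have e1 : (‖c (τ ρ)‖ : ℂ) = Complex.exp ρ := by rw [hn, Complex.ofReal_exp]
      have e2 := Complex.norm_mul_exp_arg_mul_I a
      have e3 := Complex.norm_mul_exp_arg_mul_I (c (τ ρ) / a)
      rw [norm_div, Complex.ofReal_div, e1] at e3
      have hna : (‖a‖ : ℂ) ≠ 0 := by simpa using ha
      have : Complex.exp (ρ + (Complex.arg a + Complex.arg (c (τ ρ) / a) : ℝ) * Complex.I) =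
          (‖a‖ * Complex.exp (Complex.arg a * Complex.I)) *
          (Complex.exp ρ / ‖a‖ * Complex.exp (Complex.arg (c (τ ρ) / a) * Complex.I)) := by
        rw [Complex.exp_add]
        push_cast
        rw [add_mul, Complex.exp_add]
        field_simp
      rw [this, e2, e3]
      field_simp
    · have : conj (c' (τ ρ)) * (Complex.I * c (τ ρ)) =
          Complex.I * (conj (c' (τ ρ)) * c (τ ρ)) := by ring
      rw [this, Complex.I_mul_im]
      exact hpos _ (Ioo_subset_Ioc_self ht)

end PlaneGerm

/-! ### Logarithmic polar coordinates on a surface. -/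

section LogPolar

variable {T : Type*} [TopologicalSpace T] [ChartedSpace ℂ T]

/-- Logarithmic polar coordinates about `v`, in the chart at `v`. -/
noncomputable def logPolar (v : T) (ζ : ℂ) : T :=
  (chartAt ℂ v).symm (chartAt ℂ v v + Complex.exp ζ)

theorem logPolar_add_two_pi (v : T) (ζ : ℂ) (n : ℤ) :
    logPolar v (ζ + n * (2 * Real.pi * Complex.I)) = logPolar v ζ := by
  rw [logPolar, Complex.exp_add, Complex.exp_int_mul_two_pi_mul_I, mul_one, logPolar]

theorem exists_forall_exp_of_mem_nhds {w : ℂ} {N : Set ℂ} (hN : N ∈ 𝓝 w) :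
    ∃ L : ℝ, ∀ ζ : ℂ, ζ.re < L → w + Complex.exp ζ ∈ N := by
  obtain ⟨ε, hε, h⟩ := Metric.mem_nhds_iff.1 hN
  refine ⟨Real.log ε, fun ζ hζ => h ?_⟩
  rw [Metric.mem_ball, Complex.dist_eq, add_sub_cancel_left, Complex.norm_exp]
  exact (Real.lt_log_iff_exp_lt hε).1 hζ

theorem exists_forall_logPolar_mem {v : T} {N : Set T} (hN : N ∈ 𝓝 v) :
    ∃ L : ℝ, ∀ ζ : ℂ, ζ.re < L → chartAt ℂ v v + Complex.exp ζ ∈ (chartAt ℂ v).target ∧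
      logPolar v ζ ∈ N := by
  set φ := chartAt ℂ v with hφ
  have hv : φ v ∈ φ.target := φ.map_source (mem_chart_source ℂ v)
  have h : φ.target ∩ φ.symm ⁻¹' N ∈ 𝓝 (φ v) := by
    refine inter_mem (φ.open_target.mem_nhds hv) (φ.continuousAt_symm hv ?_)
    rwa [φ.left_inv (mem_chart_source ℂ v)]
  exact exists_forall_exp_of_mem_nhds h

theorem chartAt_logPolar {v : T} {ζ : ℂ}
    (h : chartAt ℂ v v + Complex.exp ζ ∈ (chartAt ℂ v).target) :
    chartAt ℂ v (logPolar v ζ) = chartAt ℂ v v + Complex.exp ζ :=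
  (chartAt ℂ v).right_inv h

theorem logPolar_mem_source {v : T} {ζ : ℂ}
    (h : chartAt ℂ v v + Complex.exp ζ ∈ (chartAt ℂ v).target) :
    logPolar v ζ ∈ (chartAt ℂ v).source :=
  (chartAt ℂ v).map_target h

theorem continuousAt_logPolar {v : T} {ζ : ℂ}
    (h : chartAt ℂ v v + Complex.exp ζ ∈ (chartAt ℂ v).target) :
    ContinuousAt (logPolar v) ζ :=
  ContinuousAt.comp ((chartAt ℂ v).continuousAt_symm h)
    (continuous_const.add Complex.continuous_exp).continuousAt

theorem logPolar_eq_iff {v : T} {ζ ζ' : ℂ}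
    (h : chartAt ℂ v v + Complex.exp ζ ∈ (chartAt ℂ v).target)
    (h' : chartAt ℂ v v + Complex.exp ζ' ∈ (chartAt ℂ v).target) :
    logPolar v ζ = logPolar v ζ' ↔ ∃ n : ℤ, ζ = ζ' + n * (2 * Real.pi * Complex.I) := by
  rw [← Complex.exp_eq_exp_iff_exists_int]
  constructor
  · intro he
    have := congrArg (chartAt ℂ v) he
    rwa [chartAt_logPolar h, chartAt_logPolar h', add_right_inj] at this
  · intro he
    rw [logPolar, he, logPolar]

theorem logPolar_ne {v : T} {ζ : ℂ}
    (h : chartAt ℂ v v + Complex.exp ζ ∈ (chartAt ℂ v).target) : logPolar v ζ ≠ v := by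
  intro he
  have := congrArg (chartAt ℂ v) he
  rw [chartAt_logPolar h, add_eq_left] at this
  exact Complex.exp_ne_zero ζ this

/-- Logarithmic polar coordinates are open. -/
theorem image_logPolar_mem_nhds {v : T} {ζ : ℂ} {N : Set ℂ}
    (h : chartAt ℂ v v + Complex.exp ζ ∈ (chartAt ℂ v).target) (hN : N ∈ 𝓝 ζ) :
    logPolar v '' N ∈ 𝓝 (logPolar v ζ) := by
  have h1 : (fun ζ => chartAt ℂ v v + Complex.exp ζ) '' N ∈
      𝓝 (chartAt ℂ v v + Complex.exp ζ) := by
    have h2 : IsOpenMap fun ζ => chartAt ℂ v v + Complex.exp ζ :=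
      (Homeomorph.addLeft (chartAt ℂ v v)).isOpenMap.comp Complex.isOpenMap_exp
    exact h2.image_mem_nhds hN
  have h3 := (chartAt ℂ v).symm.image_mem_nhds (x := chartAt ℂ v v + Complex.exp ζ) h h1
  rw [image_image] at h3
  exact h3

/-- Every point near `v` other than `v` has logarithmic polar coordinates. -/
theorem eventually_exists_logPolar (v : T) (L : ℝ) :
    ∀ᶠ x in 𝓝 v, x ≠ v → ∃ ζ : ℂ, ζ.re < L ∧ logPolar v ζ = x := by
  have hs := mem_chart_source ℂ v
  have h1 : ∀ᶠ x in 𝓝 v, x ∈ (chartAt ℂ v).source := (chartAt ℂ v).open_source.mem_nhds hs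
  have h2 : ∀ᶠ x in 𝓝 v, chartAt ℂ v x ∈ Metric.ball (chartAt ℂ v v) (Real.exp L) :=
    (chartAt ℂ v).continuousAt hs (Metric.ball_mem_nhds _ (Real.exp_pos L))
  filter_upwards [h1, h2] with x hx1 hx2 hne
  have h3 : chartAt ℂ v x - chartAt ℂ v v ≠ 0 := by
    rw [sub_ne_zero]
    exact fun h => hne ((chartAt ℂ v).injOn hx1 hs h)
  refine ⟨Complex.log (chartAt ℂ v x - chartAt ℂ v v), ?_, ?_⟩
  · rw [Complex.log_re, Real.log_lt_iff_lt_exp (norm_pos_iff.2 h3)]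
    simpa [Complex.dist_eq] using hx2
  · rw [logPolar, Complex.exp_log h3, add_sub_cancel, (chartAt ℂ v).left_inv hx1]

end LogPolar

/-! ### The graph near a vertex. -/

namespace ArcSystem

section Vertex

variable {S T G : Type*} [Group G] [MulAction G S] {p : S → T} [TopologicalSpace T] [T2Space T]
  [ChartedSpace ℂ T] {E : ArcSystem T}

theorem IsCutSystem.eventually_notMem_vertices (v : T) :
    ∀ᶠ x in 𝓝 v, x ∈ E.vertices → x = v := by
  have : IsClosed ((E.vertices : Set T) \ {v}) := (E.vertices.finite_toSet.sdiff).isClosed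
  filter_upwards [this.isOpen_compl.mem_nhds (show v ∈ ((E.vertices : Set T) \ {v})ᶜ by simp)]
    with x hx hxv
  by_contra hne
  exact hx ⟨hxv, hne⟩

/-- Near a vertex the graph consists of the initial pieces of the edges that issue from it. -/
theorem IsCutSystem.eventually_mem_carrier_imp_vertex (hE : E.IsCutSystem G p) {v : T}
    (hv : v ∈ E.vertices) {t₁ : E.OrientedEdge → ℝ} (ht₁ : ∀ d, 0 < t₁ d) :
    ∀ᶠ x in 𝓝 v, x ∈ E.carrier → x = v ∨ ∃ d, E.start d = v ∧ ∃ t ∈ Ioo 0 (t₁ d), E.path d t = x := by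
  have h2 : ∀ e, ∀ᶠ x in 𝓝 v, ∀ t ∈ Icc (0 : ℝ) 1, t ∈ Icc (0 : ℝ) 1 → E.arc e t = x →
      x = v ∨ ∃ d, E.start d = v ∧ ∃ t ∈ Ioo 0 (t₁ d), E.path d t = x := by
    intro e
    refine isCompact_Icc.eventually_forall_of_forall_eventually fun t ht => ?_
    by_cases hne : E.arc e t = v
    · have ht' : t = 0 ∨ t = 1 := by
        by_contra h
        push Not at h
        exact hE.interior e t ⟨ht.1.lt_of_ne' h.1, ht.2.lt_of_ne h.2⟩ (hne ▸ hv)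
      -- An edge can reach `v` at either end. The end at parameter `1` is the start of the reversed
      -- edge, so a loop contributes both.
      rcases ht' with rfl | rfl
      · have h : ∀ᶠ q : T × ℝ in 𝓝 (v, 0), q.2 < t₁ (e, false) :=
          continuous_snd.continuousAt.eventually (gt_mem_nhds (ht₁ _))
        filter_upwards [h] with q hq hq1 hqx
        rcases hq1.1.eq_or_lt with h0 | h0
        · left; rw [← hqx, ← h0, hne]
        · exact Or.inr ⟨(e, false), by simpa [start, path] using hne, q.2, ⟨h0, hq⟩,
            by simpa [path] using hqx⟩
      · have h : ∀ᶠ q : T × ℝ in 𝓝 (v, 1), 1 - q.2 < t₁ (e, true) := by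
          have hc : Continuous fun q : T × ℝ => 1 - q.2 := by fun_prop
          exact hc.continuousAt.eventually (gt_mem_nhds (by simpa using ht₁ _))
        filter_upwards [h] with q hq hq1 hqx
        rcases hq1.2.eq_or_lt with h0 | h0
        · left; rw [← hqx, h0, hne]
        · exact Or.inr ⟨(e, true), by simpa [start, path] using hne, 1 - q.2,
            ⟨sub_pos.2 h0, hq⟩, by simpa [path] using hqx⟩
    · obtain ⟨A, B, hA, hB, htA, hxB, hAB⟩ := t2_separation hne
      have h3 := hE.continuousOn_arc e t ht (hA.mem_nhds htA)
      rw [mem_map, mem_nhdsWithin_iff_exists_mem_nhds_inter] at h3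
      obtain ⟨M, hM, hMA⟩ := h3
      filter_upwards [prod_mem_nhds (hB.mem_nhds hxB) hM] with q hq hq1 hqx
      exact absurd hq.1 (disjoint_left.1 hAB (hqx ▸ hMA ⟨hq.2, hq1⟩))
  filter_upwards [IsCutSystem.eventually_notMem_vertices (E := E) v, eventually_all.2 h2]
    with x hx1 hx2 hx
  rcases hx with hx | hx
  · exact Or.inl (hx1 hx)
  · obtain ⟨e, t, ht, hxt⟩ := mem_iUnion.1 hx
    exact hx2 e t ht ht hxt

variable [IsManifold 𝓘(ℂ) ω T]

/-- The initial piece of an edge in logarithmic polar coordinates about its initial vertex. -/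
theorem IsCutSystem.exists_logPolar_path (hE : E.IsCutSystem G p) (d : E.OrientedEdge) :
    ∃ t₁ > 0, ∃ (L : ℝ) (τ θ : ℝ → ℝ), Tendsto θ atBot (𝓝 (Complex.arg (E.direction d))) ∧
      (∀ ρ < L, τ ρ ∈ Ioo (0 : ℝ) 1 ∧ IsPositiveCrossing (E.path d) (τ ρ)
        (fun u : ℝ => logPolar (E.start d) (ρ + u * Complex.I)) (θ ρ)) ∧
      ∀ t ∈ Ioo 0 t₁, ∀ ζ : ℂ, ζ.re < L → E.path d t = logPolar (E.start d) ζ →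
        ∃ n : ℤ, ζ.im = θ ζ.re + n * (2 * Real.pi) := by
  set v := E.start d with hv
  set φ := chartAt ℂ v with hφ
  set a := E.direction d with ha
  have hvs : v ∈ φ.source := mem_chart_source ℂ v
  set c : ℝ → ℂ := fun t => φ (E.path d t) - φ v with hc
  have h01 : (0 : ℝ) ∈ Icc (0 : ℝ) 1 := left_mem_Icc.2 zero_le_one
  have ha0 : a ≠ 0 := hE.direction_ne_zero d
  have hcd : ContDiffWithinAt ℝ 1 c (Icc 0 1) 0 :=
    (hE.contDiffWithinAt_path d h01 hvs).sub contDiffWithinAt_const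
  have hc0 : c 0 = 0 := sub_self _
  have hda : HasDerivWithinAt c a (Icc 0 1) 0 := (hE.hasDerivWithinAt_direction d).sub_const _
  have hle : 𝓝[>] (0 : ℝ) ≤ 𝓝[Icc 0 1] 0 := by
    rw [← nhdsWithin_Ioo_eq_nhdsGT (zero_lt_one (α := ℝ))]
    exact nhdsWithin_mono _ Ioo_subset_Icc_self
  have hsrc : ∀ᶠ t in 𝓝[Icc 0 1] (0 : ℝ), E.path d t ∈ φ.source :=
    hE.continuousOn_path d 0 h01 (φ.open_source.mem_nhds hvs)
  obtain ⟨b, hb, hbs⟩ := (mem_nhdsGT_iff_exists_Ioo_subset).1 (hle hsrc)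
  replace hb : 0 < b := hb
  set c' : ℝ → ℂ := fun t => derivWithin c (Icc 0 1) t with hc'
  have hc'a : c' 0 = a := hda.derivWithin ((uniqueDiffOn_Icc zero_lt_one) 0 h01)
  have hcc : ContinuousWithinAt c' (Icc 0 1) 0 := by
    have h := (hcd.fderivWithin_right (m := 0) (uniqueDiffOn_Icc zero_lt_one) (by simp)
      h01).continuousWithinAt
    exact h.clm_apply continuousWithinAt_const
  have h0 : Tendsto (fun t : ℝ => c t / (t * a)) (𝓝[>] 0) (𝓝 1) := by
    have h := hasDerivWithinAt_iff_tendsto_slope.1 hda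
    have hle' : 𝓝[>] (0 : ℝ) ≤ 𝓝[Icc 0 1 \ {0}] 0 := by
      rw [← nhdsWithin_Ioo_eq_nhdsGT (zero_lt_one (α := ℝ))]
      exact nhdsWithin_mono _ fun t ht => ⟨Ioo_subset_Icc_self ht, ht.1.ne'⟩
    have h2 := (h.mono_left hle').div_const a
    rw [div_self ha0] at h2
    refine h2.congr fun t => ?_
    rw [slope_def_module, hc0, sub_zero, sub_zero, Complex.real_smul]
    push_cast
    rw [div_mul_eq_div_div, div_eq_inv_mul (c t)]
  have h1 : Tendsto (fun t => c' t / a) (𝓝[>] 0) (𝓝 1) := by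
    have h := (hcc.tendsto.mono_left hle).div_const a
    rwa [hc'a, div_self ha0] at h
  have hd : ∀ᶠ t in 𝓝[>] 0, HasDerivAt c (c' t) t := by
    filter_upwards [Ioo_mem_nhdsGT (lt_min hb zero_lt_one)] with t ht
    have ht1 : t ∈ Ioo (0 : ℝ) 1 := ⟨ht.1, ht.2.trans_le (min_le_right _ _)⟩
    have hts : E.path d t ∈ φ.source := hbs ⟨ht.1, ht.2.trans_le (min_le_left _ _)⟩
    have h : ContDiffWithinAt ℝ 1 c (Icc 0 1) t :=
      (hE.contDiffWithinAt_path d (Ioo_subset_Icc_self ht1) hts).sub contDiffWithinAt_const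
    exact (h.differentiableWithinAt one_ne_zero).hasDerivWithinAt.hasDerivAt
      (Icc_mem_nhds ht1.1 ht1.2)
  have hcc0 : ContinuousWithinAt c (Ici 0) 0 :=
    hcd.continuousWithinAt.mono_of_mem_nhdsWithin (Icc_mem_nhdsGE zero_lt_one)
  obtain ⟨t₁, ht₁, L₁, τ, θ, hθ, hτ, huniq⟩ :=
    exists_logPolar_param ha0 (lt_min hb zero_lt_one) hc0 hcc0 h0 h1 hd
  obtain ⟨L₂, hL₂⟩ := exists_forall_logPolar_mem (v := v) univ_mem
  have hts : ∀ t ∈ Ioo 0 t₁, t ∈ Ioo (0 : ℝ) 1 ∧ E.path d t ∈ φ.source := fun t ht =>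
    ⟨⟨ht.1, (ht.2.trans ht₁.2).trans_le (min_le_right _ _)⟩,
      hbs ⟨ht.1, (ht.2.trans ht₁.2).trans_le (min_le_left _ _)⟩⟩
  refine ⟨t₁, ht₁.1, min L₁ L₂, τ, θ, hθ, ?_, ?_⟩
  · intro ρ hρ
    obtain ⟨htρ, hcρ, hdρ, hpos⟩ := hτ ρ (hρ.trans_le (min_le_left _ _))
    obtain ⟨htρ1, htρs⟩ := hts _ htρ
    have hL : ∀ u : ℝ, φ v + Complex.exp (ρ + u * Complex.I) ∈ φ.target := fun u =>
      (hL₂ _ (by simpa using hρ.trans_le (min_le_right _ _))).1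
    refine ⟨htρ1, ⟨?_, hE.continuousAt_path d htρ1, ?_, v, htρs, c' (τ ρ), Complex.I * c (τ ρ),
      ?_, ?_, hpos⟩⟩
    · refine φ.injOn (logPolar_mem_source (hL _)) htρs ?_
      rw [chartAt_logPolar (hL _), ← hcρ, hc]
      simp [hφ]
    · refine ContinuousAt.comp (g := logPolar v) (continuousAt_logPolar (hL _)) ?_
      fun_prop
    · have h := hdρ.add_const (φ v)
      simpa [hc, Function.comp_def] using h
    · have e1 : (φ ∘ fun u : ℝ => logPolar v (ρ + u * Complex.I)) =
          fun u : ℝ => φ v + Complex.exp (ρ + u * Complex.I) := by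
        funext u
        exact chartAt_logPolar (hL u)
      rw [e1]
      have h2 : HasDerivAt (fun u : ℝ => (ρ + u * Complex.I : ℂ)) Complex.I (θ ρ) := by
        simpa using ((hasDerivAt_id' (θ ρ)).ofReal_comp.mul_const Complex.I).const_add (ρ : ℂ)
      have h3 := ((Complex.hasDerivAt_exp _).comp_of_eq (θ ρ) h2 rfl).const_add (φ v)
      rw [hcρ, mul_comm Complex.I]
      exact h3
  · intro t ht ζ hζ hpath
    have hL := (hL₂ ζ (hζ.trans_le (min_le_right _ _))).1
    have hct : c t = Complex.exp ζ := by
      simp only [hc]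
      rw [hpath, hφ, chartAt_logPolar hL, add_sub_cancel_left]
    have hζL := hζ.trans_le (min_le_left _ _)
    have htτ := huniq t ht ζ.re hζL (by rw [hct, Complex.norm_exp])
    have h := (hτ ζ.re hζL).2.1
    rw [← htτ, hct, Complex.exp_eq_exp_iff_exists_int] at h
    obtain ⟨n, hn⟩ := h
    refine ⟨n, ?_⟩
    have := congrArg Complex.im hn
    simpa using this

/-- The graph near a vertex `v`, in logarithmic polar coordinates. -/
theorem IsCutSystem.exists_logPolar_vertex (hE : E.IsCutSystem G p) {v : T}
    (hv : v ∈ E.vertices) :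
    ∃ (L : ℝ) (τ θ : E.OrientedEdge → ℝ → ℝ),
      (∀ ζ : ℂ, ζ.re < L → chartAt ℂ v v + Complex.exp ζ ∈ (chartAt ℂ v).target ∧
        logPolar v ζ ∉ E.vertices) ∧
      (∀ d, E.start d = v → Tendsto (θ d) atBot (𝓝 (Complex.arg (E.direction d)))) ∧
      (∀ d, E.start d = v → ∀ ρ < L, τ d ρ ∈ Ioo (0 : ℝ) 1 ∧ IsPositiveCrossing (E.path d) (τ d ρ)
        (fun u : ℝ => logPolar v (ρ + u * Complex.I)) (θ d ρ)) ∧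
      ∀ ζ : ℂ, ζ.re < L → logPolar v ζ ∈ E.carrier → ∃ d, E.start d = v ∧
        ∃ n : ℤ, ζ.im = θ d ζ.re + n * (2 * Real.pi) := by
  choose t₁ ht₁ L τ θ hθ hτ huniq using hE.exists_logPolar_path
  obtain ⟨L₁, hL₁⟩ := exists_forall_logPolar_mem (hE.eventually_mem_carrier_imp_vertex hv ht₁)
  obtain ⟨L₂, hL₂⟩ :=
    exists_forall_logPolar_mem (IsCutSystem.eventually_notMem_vertices (E := E) v)
  obtain ⟨L₃, hL₃⟩ : ∃ L₃, ∀ d, L₃ ≤ L d := by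
    obtain ⟨M, hM⟩ := (Set.finite_range L).bddBelow
    exact ⟨M, fun d => hM ⟨d, rfl⟩⟩
  refine ⟨min (min L₁ L₂) L₃, τ, θ, ?_, ?_, ?_, ?_⟩
  · intro ζ hζ
    obtain ⟨h1, h2⟩ := hL₂ ζ (hζ.trans_le ((min_le_left _ _).trans (min_le_right _ _)))
    exact ⟨h1, fun h => logPolar_ne h1 (h2 h)⟩
  · rintro d rfl
    exact hθ d
  · rintro d rfl ρ hρ
    exact hτ d ρ (hρ.trans_le ((min_le_right _ _).trans (hL₃ d)))
  · intro ζ hζ hcar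
    obtain ⟨h1, h2⟩ := hL₁ ζ (hζ.trans_le ((min_le_left _ _).trans (min_le_left _ _)))
    rcases h2 hcar with h | ⟨d, rfl, t, ht, hpath⟩
    · exact absurd h (logPolar_ne h1)
    · exact ⟨d, rfl, huniq d t ht ζ (hζ.trans_le ((min_le_right _ _).trans (hL₃ d))) hpath⟩

end Vertex

end ArcSystem

/-! ### Counterclockwise listing of the edge ends on the universal cover of the circle of
directions. -/

theorem IsPositiveCrossing.add_period {T : Type*} [TopologicalSpace T] [ChartedSpace ℂ T]
    {c η : ℝ → T} {t u a : ℝ} (h : IsPositiveCrossing c t η u) (ha : ∀ s, η (s + a) = η s) :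
    IsPositiveCrossing c t η (u + a) := by
  have he : η = fun s => η (s - a) := by
    funext s
    rw [← ha (s - a), sub_add_cancel]
  obtain ⟨z, hz, b, b', hb, hb', hpos⟩ := h.exists_deriv
  refine ⟨by rw [ha, h.meets], h.continuousAt_left, ?_, z, hz, b, b', hb, ?_, hpos⟩
  · rw [he]
    refine ContinuousAt.comp (g := η) ?_ (by fun_prop)
    simpa using h.continuousAt_right
  · rw [he]
    refine HasDerivAt.comp_sub_const (u + a) a (f := chartAt ℂ z ∘ η) ?_
    simpa using hb'

theorem ccwAngle_mem_Ico (a b : ℂ) : ccwAngle a b ∈ Ico 0 (2 * Real.pi) := by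
  have := toIcoMod_mem_Ico Real.two_pi_pos 0 (Complex.arg (b / a))
  simpa [ccwAngle] using this

theorem ccwAngle_self {a : ℂ} (ha : a ≠ 0) : ccwAngle a a = 0 := by
  rw [ccwAngle, div_self ha, Complex.arg_one]
  exact toIcoMod_apply_left _ _

theorem exp_arg_add_ccwAngle {a b : ℂ} (ha : a ≠ 0) (hb : b ≠ 0) :
    ∃ n : ℤ, Complex.arg a + ccwAngle a b = Complex.arg b + n * (2 * Real.pi) := by
  have h1 : ∃ m : ℤ, ccwAngle a b = Complex.arg (b / a) + m * (2 * Real.pi) := by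
    refine ⟨-toIcoDiv Real.two_pi_pos 0 (Complex.arg (b / a)), ?_⟩
    have := toIcoMod_add_toIcoDiv_zsmul Real.two_pi_pos 0 (Complex.arg (b / a))
    rw [zsmul_eq_mul] at this
    push_cast
    rw [ccwAngle]
    linarith
  obtain ⟨m, hm⟩ := h1
  have h2 : ((Complex.arg a + Complex.arg (b / a) : ℝ) : Real.Angle) = (Complex.arg b : ℝ) := by
    have h := Complex.arg_mul_coe_angle ha (div_ne_zero hb ha)
    rw [mul_div_cancel₀ _ ha] at h
    rw [h, Real.Angle.coe_add]
  rw [Real.Angle.angle_eq_iff_two_pi_dvd_sub] at h2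
  obtain ⟨n, hn⟩ := h2
  refine ⟨n + m, ?_⟩
  rw [hm]
  push_cast
  linarith

namespace ArcSystem

section Listing

variable {S T G : Type*} [Group G] [MulAction G S] {p : S → T} [TopologicalSpace T]
  [ChartedSpace ℂ T] {E : ArcSystem T} {v : T} {e : ℕ → E.OrientedEdge}

/-- The periodic extension to `ℤ` of a list of the oriented edges that issue from `v`. -/
noncomputable def intEdge (E : ArcSystem T) (v : T) (e : ℕ → E.OrientedEdge) (j : ℤ) : E.OrientedEdge :=
  e (j % E.valence v).toNat

/-- The directions of the oriented edges that issue from `v`, as an increasing list of angles. -/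
noncomputable def intAngle (E : ArcSystem T) (v : T) (e : ℕ → E.OrientedEdge) (j : ℤ) : ℝ :=
  Complex.arg (E.direction (e 0)) +
    ccwAngle (E.direction (e 0)) (E.direction (E.intEdge v e j)) +
    (j / (E.valence v : ℤ) : ℤ) * (2 * Real.pi)

theorem IsCounterclockwise.intEdge_natCast (he : E.IsCounterclockwise v e) (n : ℕ) :
    E.intEdge v e n = e n := by
  have h : ∀ q m : ℕ, e (m + q * E.valence v) = e m := by
    intro q
    induction q with
    | zero => simp
    | succ q ih =>
      intro m
      rw [Nat.succ_mul, ← add_assoc, he.periodic, ih]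
  rw [intEdge, ← Int.natCast_mod, Int.toNat_natCast]
  conv_rhs => rw [← Nat.mod_add_div n (E.valence v), mul_comm (E.valence v)]
  rw [h]

theorem intEdge_add_mul (E : ArcSystem T) (v : T) (e : ℕ → E.OrientedEdge) (j n : ℤ) :
    E.intEdge v e (j + n * E.valence v) = E.intEdge v e j := by
  rw [intEdge, intEdge, Int.add_mul_emod_self_right]

theorem intAngle_add_mul (hk : 0 < E.valence v) (j n : ℤ) :
    E.intAngle v e (j + n * E.valence v) = E.intAngle v e j + n * (2 * Real.pi) := by
  rw [intAngle, intEdge_add_mul, intAngle, Int.add_mul_ediv_right _ _ (by exact_mod_cast hk.ne')]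
  push_cast
  ring

theorem toNat_emod_lt {k : ℕ} (hk : 0 < k) (j : ℤ) : (j % k).toNat < k := by
  have h1 := Int.emod_nonneg j (by exact_mod_cast hk.ne' : (k : ℤ) ≠ 0)
  have h2 := Int.emod_lt_of_pos j (by exact_mod_cast hk : (0 : ℤ) < k)
  omega

theorem IsCounterclockwise.start_intEdge (he : E.IsCounterclockwise v e)
    (hk : 0 < E.valence v) (j : ℤ) : E.start (E.intEdge v e j) = v :=
  he.enumerates.mapsTo (toNat_emod_lt hk j)

theorem IsCounterclockwise.exists_intEdge_eq (he : E.IsCounterclockwise v e)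
    {d : E.OrientedEdge} (hd : E.start d = v) : ∃ j : ℤ, E.intEdge v e j = d := by
  obtain ⟨i, -, hi⟩ := he.enumerates.surjOn hd
  exact ⟨i, by rw [he.intEdge_natCast, hi]⟩

/-- Within a round this is the counterclockwise order. Between rounds it holds because the angles of
a round start at `0` and stay below `2π`. -/
theorem IsCounterclockwise.strictMono_intAngle (he : E.IsCounterclockwise v e)
    (hk : 0 < E.valence v) (hdir : E.direction (e 0) ≠ 0) : StrictMono (E.intAngle v e) := by
  refine strictMono_int_of_lt_succ fun j => ?_
  have hj := Int.emod_add_mul_ediv j (E.valence v)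
  have hr : (j % E.valence v) = ((j % E.valence v).toNat : ℤ) := by
    rw [Int.toNat_of_nonneg (Int.emod_nonneg j (by exact_mod_cast hk.ne'))]
  have hrk := toNat_emod_lt hk j
  set r := (j % E.valence v).toNat with hrdef
  set q := j / E.valence v with hq
  have e1 : j = (r : ℤ) + q * E.valence v := by
    rw [← hr, mul_comm]
    exact hj.symm
  have e2 : j + 1 = ((r + 1 : ℕ) : ℤ) + q * E.valence v := by
    push_cast
    omega
  rw [e2]
  nth_rewrite 1 [e1]
  rw [intAngle_add_mul hk, intAngle_add_mul hk]
  gcongr ?_ + _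
  have hA : ∀ i : ℕ, i < E.valence v → E.intAngle v e i = Complex.arg (E.direction (e 0)) +
      ccwAngle (E.direction (e 0)) (E.direction (e i)) := by
    intro i hi
    rw [intAngle, he.intEdge_natCast, Int.ediv_eq_zero_of_lt (by positivity) (by exact_mod_cast hi)]
    simp
  by_cases h : r + 1 < E.valence v
  · rw [hA r hrk, hA (r + 1) h]
    gcongr ?_ + ?_
    exact he.increasing hrk h (Nat.lt_succ_self r)
  · have hr1 : r + 1 = E.valence v := by omega
    have e3 : (((r + 1 : ℕ) : ℤ)) = 0 + 1 * E.valence v := by rw [hr1]; ring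
    have h0 := hA 0 hk
    rw [Nat.cast_zero, ccwAngle_self hdir] at h0
    rw [e3, intAngle_add_mul hk, h0, hA r hrk]
    have := (ccwAngle_mem_Ico (E.direction (e 0)) (E.direction (e r))).2
    push_cast
    linarith

/-- Consecutive gaps depend only on the index modulo the valence, so there is a smallest one, and
`η` is half of it. Graphs within `η` of these angles remain in order. -/
theorem IsCounterclockwise.exists_gap (he : E.IsCounterclockwise v e)
    (hk : 0 < E.valence v) (hdir : E.direction (e 0) ≠ 0) :
    ∃ η > 0, ∀ j, E.intAngle v e j + 2 * η ≤ E.intAngle v e (j + 1) := by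
  have hmono := he.strictMono_intAngle hk hdir
  have hne : (Finset.range (E.valence v)).Nonempty := Finset.nonempty_range_iff.2 hk.ne'
  obtain ⟨i₀, -, hi₀⟩ := Finset.exists_min_image (Finset.range (E.valence v))
    (fun i : ℕ => E.intAngle v e ((i : ℤ) + 1) - E.intAngle v e i) hne
  refine ⟨(E.intAngle v e ((i₀ : ℤ) + 1) - E.intAngle v e i₀) / 2,
    half_pos (sub_pos.2 (hmono (lt_add_one _))), fun j => ?_⟩
  have hj := Int.emod_add_mul_ediv j (E.valence v)
  have hr : (j % E.valence v) = ((j % E.valence v).toNat : ℤ) := by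
    rw [Int.toNat_of_nonneg (Int.emod_nonneg j (by exact_mod_cast hk.ne'))]
  have hrk := toNat_emod_lt hk j
  have h := hi₀ _ (Finset.mem_range.2 hrk)
  have e1 : j = ((j % E.valence v).toNat : ℤ) + (j / E.valence v) * E.valence v := by
    rw [← hr, mul_comm]
    exact hj.symm
  have e2 : j + 1 = (((j % E.valence v).toNat : ℤ) + 1) + (j / E.valence v) * E.valence v := by
    omega
  have h1 : E.intAngle v e j = _ := (congrArg _ e1).trans (intAngle_add_mul hk _ _)
  have h2 : E.intAngle v e (j + 1) = _ := (congrArg _ e2).trans (intAngle_add_mul hk _ _)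
  rw [h1, h2]
  linarith

variable [T2Space T] [IsManifold 𝓘(ℂ) ω T]

theorem IsCutSystem.exists_arg_eq_intAngle (hE : E.IsCutSystem G p) (j : ℤ) :
    ∃ n : ℤ, E.intAngle v e j =
      Complex.arg (E.direction (E.intEdge v e j)) + n * (2 * Real.pi) := by
  obtain ⟨n, hn⟩ := exp_arg_add_ccwAngle (hE.direction_ne_zero (e 0))
    (hE.direction_ne_zero (E.intEdge v e j))
  refine ⟨n + j / (E.valence v : ℤ), ?_⟩
  rw [intAngle, hn]
  push_cast
  ring

theorem IsCutSystem.direction_intEdge (hE : E.IsCutSystem G p) (j : ℤ) :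
    E.direction (E.intEdge v e j) = ‖E.direction (E.intEdge v e j)‖ *
      Complex.exp (E.intAngle v e j * Complex.I) := by
  obtain ⟨n, hn⟩ := hE.exists_arg_eq_intAngle (v := v) (e := e) j
  rw [hn]
  push_cast
  rw [add_mul, Complex.exp_add, mul_assoc (n : ℂ), Complex.exp_int_mul_two_pi_mul_I, mul_one,
    Complex.norm_mul_exp_arg_mul_I]

/-- The graph near a vertex, in logarithmic polar coordinates, with its edge ends listed
counterclockwise: the `j`-th edge end is the graph of `φ j`. -/
theorem IsCutSystem.exists_sectors (hE : E.IsCutSystem G p) (hv : v ∈ E.vertices)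
    (he : E.IsCounterclockwise v e) (hk : 0 < E.valence v) {η : ℝ} (hη : 0 < η) :
    ∃ (L : ℝ) (φ : ℤ → ℝ → ℝ),
      (∀ ζ : ℂ, ζ.re < L → chartAt ℂ v v + Complex.exp ζ ∈ (chartAt ℂ v).target ∧
        logPolar v ζ ∉ E.vertices) ∧
      (∀ j, Tendsto (φ j) atBot (𝓝 (E.intAngle v e j))) ∧
      (∀ ρ < L, ∀ j, |φ j ρ - E.intAngle v e j| < η) ∧
      (∀ j n : ℤ, ∀ ρ, φ (j + n * E.valence v) ρ = φ j ρ + n * (2 * Real.pi)) ∧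
      (∀ ρ < L, ∀ j, ∃ t ∈ Ioo (0 : ℝ) 1, IsPositiveCrossing (E.path (E.intEdge v e j)) t
        (fun u : ℝ => logPolar v (ρ + u * Complex.I)) (φ j ρ)) ∧
      ∀ ζ : ℂ, ζ.re < L → logPolar v ζ ∈ E.carrier → ∃ j, ζ.im = φ j ζ.re := by
  obtain ⟨L, τ, θ, hL, hθ, hτ, hcar⟩ := hE.exists_logPolar_vertex hv
  have hclose : ∀ᶠ ρ in atBot, ∀ d, E.start d = v →
      |θ d ρ - Complex.arg (E.direction d)| < η := by
    refine eventually_all.2 fun d => ?_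
    by_cases hd : E.start d = v
    · have := (hθ d hd) (Metric.ball_mem_nhds _ hη)
      filter_upwards [this] with ρ hρ _
      exact hρ
    · exact Eventually.of_forall fun ρ h => absurd h hd
  obtain ⟨L', hL'⟩ := eventually_atBot.1 hclose
  -- The angle function of the edge end is shifted by a multiple of `2π`, so that its limit is the
  -- `j`-th angle and not the principal argument.
  set φ : ℤ → ℝ → ℝ := fun j ρ => θ (E.intEdge v e j) ρ +
    (E.intAngle v e j - Complex.arg (E.direction (E.intEdge v e j))) with hφ
  have hper : ∀ j n : ℤ, ∀ ρ, φ (j + n * E.valence v) ρ = φ j ρ + n * (2 * Real.pi) := by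
    intro j n ρ
    simp only [hφ]
    rw [intEdge_add_mul, intAngle_add_mul hk]
    ring
  refine ⟨min L L', φ, fun ζ hζ => hL ζ (hζ.trans_le (min_le_left _ _)), ?_, ?_, hper, ?_, ?_⟩
  · intro j
    have h := (hθ _ (he.start_intEdge hk j)).add_const
      (E.intAngle v e j - Complex.arg (E.direction (E.intEdge v e j)))
    rwa [add_sub_cancel] at h
  · intro ρ hρ j
    have h := hL' ρ (hρ.le.trans (min_le_right _ _)) _ (he.start_intEdge hk j)
    convert h using 2
    simp only [hφ]
    ring
  · intro ρ hρ j
    obtain ⟨ht, hc⟩ := hτ _ (he.start_intEdge hk j) ρ (hρ.trans_le (min_le_left _ _))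
    refine ⟨_, ht, ?_⟩
    obtain ⟨n, hn⟩ := hE.exists_arg_eq_intAngle (v := v) (e := e) j
    have h : φ j ρ = θ (E.intEdge v e j) ρ + n * (2 * Real.pi) := by
      simp only [hφ]
      rw [hn]
      ring
    rw [h]
    refine hc.add_period fun s => ?_
    refine Eq.trans ?_ (logPolar_add_two_pi v _ n)
    congr 1
    push_cast
    ring
  · intro ζ hζ hζc
    obtain ⟨d, hd, n, hn⟩ := hcar ζ (hζ.trans_le (min_le_left _ _)) hζc
    obtain ⟨j, rfl⟩ := he.exists_intEdge_eq hd
    obtain ⟨m, hm⟩ := hE.exists_arg_eq_intAngle (v := v) (e := e) j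
    refine ⟨j + (n - m) * E.valence v, ?_⟩
    rw [hper, hn]
    simp only [hφ]
    rw [hm]
    push_cast
    ring

end Listing

end ArcSystem

/-! ### Lifting a punctured neighbourhood of a point of the quotient. -/

section Lift

variable {S T G : Type*} [TopologicalSpace S] [T2Space S] [CompactSpace S] [ChartedSpace ℂ S]
  [TopologicalSpace T] [T2Space T] [ChartedSpace ℂ T] [Group G] [Finite G] [MulAction G S]
  [ContinuousConstSMul G S] {p : S → T}

/-- Punctured neighbourhoods of a point of a surface contain preconnected ones. -/
theorem exists_mem_nhds_isPreconnected_diff {X : Type*} [TopologicalSpace X] [ChartedSpace ℂ X]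
    {w : X} {N : Set X} (hN : N ∈ 𝓝 w) :
    ∃ B ∈ 𝓝 w, B ⊆ N ∧ IsPreconnected (B \ {w}) := by
  obtain ⟨L, hL⟩ := exists_forall_logPolar_mem hN
  refine ⟨insert w (logPolar w '' {ζ | ζ.re < L}), ?_, ?_, ?_⟩
  · filter_upwards [eventually_exists_logPolar w L] with x hx
    by_cases h : x = w
    · exact Or.inl h
    · exact Or.inr (hx h)
  · rintro x (rfl | ⟨ζ, hζ, rfl⟩)
    · exact mem_of_mem_nhds hN
    · exact (hL ζ hζ).2
  · have h : insert w (logPolar w '' {ζ | ζ.re < L}) \ {w} = logPolar w '' {ζ | ζ.re < L} := by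
      ext x
      constructor
      · rintro ⟨h | h, hx⟩
        · exact absurd h hx
        · exact h
      · rintro ⟨ζ, hζ, rfl⟩
        exact ⟨Or.inr ⟨ζ, hζ, rfl⟩, logPolar_ne (hL ζ hζ).1⟩
    rw [h]
    exact (convex_halfSpace_re_lt L).isPreconnected.image _ fun ζ hζ =>
      (continuousAt_logPolar (hL ζ hζ).1).continuousWithinAt

/-- A neighbourhood of `w` that is invariant under the stabilizer of `w` and disjoint from its
translates by other elements. -/
theorem exists_isOpen_smul_mem_iff (G : Type*) {S : Type*} [TopologicalSpace S] [T2Space S]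
    [Group G] [Finite G] [MulAction G S] [ContinuousConstSMul G S] (w : S) :
    ∃ W : Set S, IsOpen W ∧ w ∈ W ∧
      ∀ x ∈ W, ∀ g : G, g • x ∈ W ↔ g ∈ MulAction.stabilizer G w := by
  obtain ⟨V, hV, hwV, h⟩ := exists_isOpen_smul_inter_nonempty G w
  refine ⟨⋃ g : MulAction.stabilizer G w, (g : G) • V, isOpen_iUnion fun g => hV.smul (g : G),
    mem_iUnion.2 ⟨1, by simpa using hwV⟩, ?_⟩
  intro x hx g
  obtain ⟨a, y, hy, rfl⟩ := mem_iUnion.1 hx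
  constructor
  · intro hg
    obtain ⟨b, y', hy', hyy⟩ := mem_iUnion.1 hg
    have h1 : ((b : G)⁻¹ * g * a) • w = w := by
      refine h _ ⟨y', ⟨y, hy, ?_⟩, hy'⟩
      simp only [mul_smul]
      rw [inv_smul_eq_iff]
      exact hyy.symm
    have h2 : (b : G)⁻¹ * g * a ∈ MulAction.stabilizer G w := h1
    have h3 := mul_mem (mul_mem b.2 h2) (inv_mem a.2)
    simpa [mul_assoc] using h3
  · intro hg
    refine mem_iUnion.2 ⟨⟨g, hg⟩ * a, y, hy, ?_⟩
    simp [mul_smul]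

/-- In an invariant neighbourhood `W` of `w`, points over points near `p w` are near `w`. -/
theorem IsOrbitMap.exists_mem_nhds_of_map_mem (hp : IsOrbitMap G p) {w : S} {W : Set S}
    (hW : IsOpen W) (hwW : w ∈ W)
    (hG : ∀ x ∈ W, ∀ g : G, g • x ∈ W ↔ g ∈ MulAction.stabilizer G w) {N : Set S}
    (hN : N ∈ 𝓝 w) : ∃ M ∈ 𝓝 (p w), ∀ x ∈ W, p x ∈ M → x ∈ N := by
  have h1 : ∀ᶠ y in 𝓝 w, ∀ g : G, g • w = w → g • y ∈ N := by
    refine eventually_all.2 fun g => ?_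
    by_cases hg : g • w = w
    · have : Tendsto (g • · : S → S) (𝓝 w) (𝓝 w) := by
        have h := (continuous_const_smul g).tendsto w
        rwa [hg] at h
      filter_upwards [this hN] with y hy _
      exact hy
    · exact Eventually.of_forall fun y h => absurd h hg
  refine ⟨_, hp.isOpenMap.image_mem_nhds (inter_mem h1 (hW.mem_nhds hwW)), ?_⟩
  rintro x hx ⟨y, ⟨hy, hyW⟩, hxy⟩
  obtain ⟨g, rfl⟩ := (hp.fibre y x).1 hxy
  exact hy g ((hG y hyW g).1 hx)

/-- A lift of logarithmic polar coordinates about `p w` to logarithmic polar coordinates on a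
punctured neighbourhood of `w`; a full turn lifts to a generator `s` of the stabilizer. -/
structure IsLogPolarLift (p : S → T) (w : S) (L : ℝ) (Ψ : ℂ → S) (s : G) : Prop where
  continuousOn : ContinuousOn Ψ {ζ | ζ.re < L}
  map_eq : ∀ ζ : ℂ, ζ.re < L → p (Ψ ζ) = logPolar (p w) ζ
  turn : ∀ ζ : ℂ, ζ.re < L → ∀ n : ℤ, Ψ (ζ + n * (2 * Real.pi * Complex.I)) = s ^ n • Ψ ζ
  zpowers_eq : Subgroup.zpowers s = MulAction.stabilizer G w
  near : ∀ N ∈ 𝓝 w, ∃ L' : ℝ, ∀ ζ : ℂ, ζ.re < L → ζ.re < L' → Ψ ζ ∈ N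
  surj : ∀ᶠ x in 𝓝 w, x ≠ w → ∃ ζ : ℂ, ζ.re < L ∧ Ψ ζ = x

/-- `logPolar` is open and `p` is locally injective off the cone points, so a lift of `logPolar`
through `p` is open. -/
theorem IsOrbitMap.image_lift_mem_nhds (hp : IsOrbitMap G p) {v : T} {L : ℝ}
    (hL : ∀ ζ : ℂ, ζ.re < L → chartAt ℂ v v + Complex.exp ζ ∈ (chartAt ℂ v).target ∧
      ¬ IsConePoint G p (logPolar v ζ)) {Ψ : ℂ → S}
    (hΨc : ContinuousOn Ψ {ζ | ζ.re < L})
    (hΨ : ∀ ζ : ℂ, ζ.re < L → p (Ψ ζ) = logPolar v ζ) :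
    IsOpen (Ψ '' {ζ | ζ.re < L}) := by
  have hH : IsOpen {ζ : ℂ | ζ.re < L} := isOpen_lt Complex.continuous_re continuous_const
  rw [isOpen_iff_mem_nhds]
  rintro _ ⟨ζ, hζ, rfl⟩
  obtain ⟨O, hO, hxO, hinj⟩ := hp.exists_isOpen_injOn (x := Ψ ζ)
    (by rw [hΨ ζ hζ]; exact (hL ζ hζ).2)
  have h1 : Ψ ⁻¹' O ∩ {ζ | ζ.re < L} ∈ 𝓝 ζ :=
    inter_mem ((hΨc.continuousAt (hH.mem_nhds hζ)) (hO.mem_nhds hxO)) (hH.mem_nhds hζ)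
  have h2 := image_logPolar_mem_nhds (hL ζ hζ).1 h1
  rw [← hΨ ζ hζ] at h2
  filter_upwards [hO.mem_nhds hxO, hp.continuous.continuousAt h2] with y hy hy'
  obtain ⟨ζ', ⟨hζ'O, hζ'⟩, h⟩ := hy'
  refine ⟨ζ', hζ', hinj hζ'O hy ?_⟩
  rw [hΨ ζ' hζ', h]

/-- A half-plane is simply connected, so `logPolar` lifts with any prescribed value over `ζ₁`, and a
turn by `2πi` acts on the lift as some `s` in the stabilizer. The image of the lift is open and
disjoint from its translates by elements outside the powers of `s`. As a punctured neighbourhood of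
`w` is connected, the image contains it, and therefore `s` generates the stabilizer. `L` and `N`
precede `x` so that the lift can be made to pass through a chosen point near `w`. -/
theorem IsOrbitMap.exists_isLogPolarLift (hp : IsOrbitMap G p) (w : S) {L₀ : ℝ}
    (hL₀ : ∀ ζ : ℂ, ζ.re < L₀ → chartAt ℂ (p w) (p w) + Complex.exp ζ ∈ (chartAt ℂ (p w)).target ∧
      ¬ IsConePoint G p (logPolar (p w) ζ)) :
    ∃ L ≤ L₀, ∃ N ∈ 𝓝 w, ∀ x ∈ N, ∀ ζ₁ : ℂ, ζ₁.re < L → p x = logPolar (p w) ζ₁ →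
      ∃ (Ψ : ℂ → S) (s : G), IsLogPolarLift p w L Ψ s ∧ Ψ ζ₁ = x := by
  obtain ⟨W, hW, hwW, hG⟩ := exists_isOpen_smul_mem_iff G w
  obtain ⟨L₁, hL₁⟩ := exists_forall_logPolar_mem (hp.isOpenMap.image_mem_nhds (hW.mem_nhds hwW))
  set L := min L₀ L₁ with hLdef
  have hL : ∀ ζ : ℂ, ζ.re < L → chartAt ℂ (p w) (p w) + Complex.exp ζ ∈ (chartAt ℂ (p w)).target ∧
      ¬ IsConePoint G p (logPolar (p w) ζ) := fun ζ hζ => hL₀ ζ (hζ.trans_le (min_le_left _ _))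
  have hN : W ∩ p ⁻¹' {z | z ≠ p w → ∃ ζ : ℂ, ζ.re < L ∧ logPolar (p w) ζ = z} ∈ 𝓝 w :=
    inter_mem (hW.mem_nhds hwW)
      (hp.continuous.continuousAt.eventually (eventually_exists_logPolar (p w) L))
  obtain ⟨B, hB, hBN, hBconn⟩ := exists_mem_nhds_isPreconnected_diff hN
  refine ⟨L, min_le_left _ _, B, hB, fun x₁ hx₁ ζ₁ hζ₁ hpx₁ => ?_⟩
  have hconv : Convex ℝ {ζ : ℂ | ζ.re < L} := convex_halfSpace_re_lt L
  have hΦc : ContinuousOn (logPolar (p w)) {ζ | ζ.re < L} := fun ζ hζ =>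
    (continuousAt_logPolar (hL ζ hζ).1).continuousWithinAt
  obtain ⟨Ψ, hΨc, hΨ₁, hΨp⟩ := hp.exists_lift_of_convex hconv hΦc
    (fun ζ hζ => (hL ζ hζ).2) (a₀ := ζ₁) hζ₁ hpx₁
  have hshift : ∀ ζ : ℂ, ζ.re < L → ∀ n : ℤ, (ζ + n * (2 * Real.pi * Complex.I)).re < L := by
    intro ζ hζ n
    simpa using hζ
  have hne : ∀ ζ : ℂ, ζ.re < L → Ψ ζ ≠ w := fun ζ hζ h => logPolar_ne (hL ζ hζ).1 (by
    rw [← hΨp ζ hζ, h])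
  -- The connected image of `Ψ` meets `W` and is covered by `W` and the translates of `W` by
  -- elements moving `w`, an open set disjoint from `W`.
  have hΨW : ∀ ζ : ℂ, ζ.re < L → Ψ ζ ∈ W := by
    have hcov : Ψ '' {ζ | ζ.re < L} ⊆ W ∪ ⋃ g : {g : G // g • w ≠ w}, (g : G) • W := by
      rintro _ ⟨ζ, hζ, rfl⟩
      obtain ⟨y, hy, hyp⟩ := (hL₁ ζ (lt_of_lt_of_le hζ (min_le_right _ _))).2
      rw [← hΨp ζ hζ] at hyp
      obtain ⟨g, hg⟩ := (hp.fibre _ _).1 hyp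
      by_cases hgw : g • w = w
      · left
        rw [← hg]
        exact (hG y hy g).2 hgw
      · exact Or.inr (mem_iUnion.2 ⟨⟨g, hgw⟩, y, hy, hg⟩)
    have hdisj : Disjoint W (⋃ g : {g : G // g • w ≠ w}, (g : G) • W) := by
      rw [disjoint_left]
      intro x hx hx'
      obtain ⟨g, y, hy, rfl⟩ := mem_iUnion.1 hx'
      exact g.2 ((hG y hy g).1 hx)
    have := (hconv.isPreconnected.image Ψ hΨc).subset_left_of_subset_union hW
      (isOpen_iUnion fun g : {g : G // g • w ≠ w} => hW.smul (g : G)) hdisj hcov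
      ⟨x₁, ⟨ζ₁, hζ₁, hΨ₁⟩, (hBN hx₁).1⟩
    exact fun ζ hζ => this ⟨ζ, hζ, rfl⟩
  obtain ⟨s, hs⟩ : ∃ s : G, s • Ψ ζ₁ = Ψ (ζ₁ + (1 : ℤ) * (2 * Real.pi * Complex.I)) := by
    refine (hp.fibre _ _).1 ?_
    rw [hΨp _ hζ₁, hΨp _ (hshift _ hζ₁ 1), logPolar_add_two_pi]
  have hsw : s ∈ MulAction.stabilizer G w :=
    (hG _ (hΨW _ hζ₁) s).1 (by rw [hs]; exact hΨW _ (hshift _ hζ₁ 1))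
  have hturn1 : ∀ ζ : ℂ, ζ.re < L → Ψ (ζ + (1 : ℤ) * (2 * Real.pi * Complex.I)) = s • Ψ ζ := by
    have h := hp.eqOn_of_isPreconnected hconv.isPreconnected
      (f := fun ζ => Ψ (ζ + (1 : ℤ) * (2 * Real.pi * Complex.I))) (f' := fun ζ => s • Ψ ζ)
      (hΨc.comp (by fun_prop) fun ζ hζ => hshift ζ hζ 1) (hΨc.const_smul s) ?_ ?_ hζ₁ hs.symm
    · exact fun ζ hζ => h hζ
    · intro ζ hζ
      rw [hΨp _ (hshift ζ hζ 1)]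
      exact (hL _ (hshift ζ hζ 1)).2
    · intro ζ hζ
      rw [hΨp _ (hshift ζ hζ 1), hp.map_smul, hΨp ζ hζ, logPolar_add_two_pi]
  have hturn : ∀ ζ : ℂ, ζ.re < L → ∀ n : ℤ,
      Ψ (ζ + n * (2 * Real.pi * Complex.I)) = s ^ n • Ψ ζ := by
    intro ζ hζ n
    induction n with
    | zero => simp
    | succ n ih =>
      rw [zpow_add, zpow_one, ← (Commute.refl s).zpow_right n |>.eq, mul_smul, ← ih,
        ← hturn1 _ (hshift ζ hζ n)]
      congr 1
      push_cast
      ring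
    | pred n ih =>
      have h := hturn1 _ (hshift ζ hζ (-n - 1))
      rw [zpow_sub, zpow_one, ← (Commute.refl s).zpow_right (-n : ℤ) |>.inv_left.eq, mul_smul, ← ih,
        eq_inv_smul_iff, ← h]
      congr 1
      push_cast
      ring
  have hnear : ∀ N ∈ 𝓝 w, ∃ L' : ℝ, ∀ ζ : ℂ, ζ.re < L → ζ.re < L' → Ψ ζ ∈ N := by
    intro N hN
    obtain ⟨M, hM, hMN⟩ := hp.exists_mem_nhds_of_map_mem hW hwW hG hN
    obtain ⟨L', hL'⟩ := exists_forall_logPolar_mem hM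
    exact ⟨L', fun ζ hζ hζ' => hMN _ (hΨW ζ hζ) (by rw [hΨp ζ hζ]; exact (hL' ζ hζ').2)⟩
  have hpow : ∀ ζ ζ' : ℂ, ζ.re < L → ζ'.re < L → ∀ g : G, Ψ ζ = g • Ψ ζ' →
      g ∈ Subgroup.zpowers s := by
    intro ζ ζ' hζ hζ' g h
    have h1 : logPolar (p w) ζ = logPolar (p w) ζ' := by
      rw [← hΨp ζ hζ, ← hΨp ζ' hζ', h, hp.map_smul]
    obtain ⟨n, rfl⟩ := (logPolar_eq_iff (hL ζ hζ).1 (hL ζ' hζ').1).1 h1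
    rw [hturn ζ' hζ'] at h
    exact ⟨n, IsOrbitMap.smul_left_cancel (p := p) (by rw [hΨp ζ' hζ']; exact (hL ζ' hζ').2) h⟩
  have hAopen := hp.image_lift_mem_nhds hL hΨc hΨp
  -- Connectedness of the punctured neighbourhood: the image of `Ψ` and the union of its other
  -- translates are disjoint open sets covering it.
  have hsub : B \ {w} ⊆ Ψ '' {ζ | ζ.re < L} := by
    have hcov : B \ {w} ⊆ Ψ '' {ζ | ζ.re < L} ∪
        ⋃ g : {g : G // g ∉ Subgroup.zpowers s}, (g : G) • (Ψ '' {ζ | ζ.re < L}) := by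
      rintro x ⟨hxB, hxw⟩
      obtain ⟨hxW, hx⟩ := hBN hxB
      have hxne : p x ≠ p w := by
        intro h
        obtain ⟨g, hg⟩ := (hp.fibre w x).1 h.symm
        have hg' := (hG w hwW g).1 (by rw [hg]; exact hxW)
        exact hxw (by rw [mem_singleton_iff, ← hg]; exact hg')
      obtain ⟨ζ, hζ, hζx⟩ := hx hxne
      rw [← hΨp ζ hζ] at hζx
      obtain ⟨g, hg⟩ := (hp.fibre _ _).1 hζx
      by_cases hgs : g ∈ Subgroup.zpowers s
      · obtain ⟨n, rfl⟩ := hgs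
        exact Or.inl ⟨_, hshift ζ hζ n, by rw [hturn ζ hζ n]; exact hg⟩
      · exact Or.inr (mem_iUnion.2 ⟨⟨g, hgs⟩, _, ⟨ζ, hζ, rfl⟩, hg⟩)
    have hdisj : Disjoint (Ψ '' {ζ | ζ.re < L})
        (⋃ g : {g : G // g ∉ Subgroup.zpowers s}, (g : G) • (Ψ '' {ζ | ζ.re < L})) := by
      rw [disjoint_left]
      rintro _ ⟨ζ, hζ, rfl⟩ hx'
      obtain ⟨g, _, ⟨ζ', hζ', rfl⟩, h⟩ := mem_iUnion.1 hx'
      exact g.2 (hpow ζ ζ' hζ hζ' g h.symm)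
    refine hBconn.subset_left_of_subset_union hAopen
      (isOpen_iUnion fun g : {g : G // g ∉ Subgroup.zpowers s} => hAopen.smul (g : G)) hdisj hcov ⟨x₁, ⟨hx₁, ?_⟩, ζ₁, hζ₁, hΨ₁⟩
    rw [← hΨ₁]
    exact hne ζ₁ hζ₁
  refine ⟨Ψ, s, ⟨hΨc, hΨp, hturn, ?_, hnear, ?_⟩, hΨ₁⟩
  -- A stabilizer element `g` carries a point `Ψ r` close to `w` to another point of the punctured
  -- neighbourhood, hence into the image of `Ψ`; by `hpow` it is then a power of `s`.
  · refine le_antisymm (by rwa [Subgroup.zpowers_le]) fun g hg => ?_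
    have hgB : B ∩ (g • · : S → S) ⁻¹' B ∈ 𝓝 w := by
      refine inter_mem hB ((continuous_const_smul g).continuousAt ?_)
      rwa [show g • w = w from hg]
    obtain ⟨L', hL'⟩ := hnear _ hgB
    obtain ⟨r, hr⟩ := exists_lt (min L L')
    have hrL : ((r : ℂ)).re < L := by simpa using hr.trans_le (min_le_left _ _)
    have hrL' : ((r : ℂ)).re < L' := by simpa using hr.trans_le (min_le_right _ _)
    have hgΨ : g • Ψ r ≠ w := by
      intro h
      refine hne r hrL ?_
      rw [← inv_smul_eq_iff.2 h.symm]
      exact inv_smul_eq_iff.2 (show g • w = w from hg).symm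
    obtain ⟨ζ, hζ, h⟩ := hsub ⟨(hL' r hrL hrL').2, hgΨ⟩
    exact hpow ζ r hζ hrL g h
  · filter_upwards [hB] with x hx hxw
    exact hsub ⟨hx, hxw⟩

end Lift

/-! ### Straight rays in logarithmic polar coordinates. -/

namespace ArcSystem

section Rays

variable {T : Type*} [TopologicalSpace T] [ChartedSpace ℂ T] {E : ArcSystem T}

theorem eventually_re_lt (v : T) (L : ℝ) :
    ∀ᶠ x in 𝓝 v, ∀ ζ : ℂ, chartAt ℂ v x = chartAt ℂ v v + Complex.exp ζ → ζ.re < L := by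
  filter_upwards [(chartAt ℂ v).continuousAt (mem_chart_source ℂ v)
    (Metric.ball_mem_nhds _ (Real.exp_pos L))] with x hx ζ hζ
  rw [mem_preimage, hζ, Metric.mem_ball, Complex.dist_eq, add_sub_cancel_left, Complex.norm_exp] at hx
  exact Real.exp_lt_exp.1 hx

/-- A straight ray becomes a horizontal line. Any argument `α` of the direction is allowed, so that
`intAngle`, which keeps track of the round, can be used. -/
theorem exists_logPolar_of_mem_ray {d : E.OrientedEdge} {α θ : ℝ} (hd : E.direction d ≠ 0)
    (hα : E.direction d = ‖E.direction d‖ * Complex.exp (α * Complex.I)) {x : T}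
    (hx : x ∈ E.ray d θ) :
    ∃ ρ : ℝ, x = logPolar (E.start d) (ρ + (α - θ : ℝ) * Complex.I) ∧
      chartAt ℂ (E.start d) x = chartAt ℂ (E.start d) (E.start d) +
        Complex.exp (ρ + (α - θ : ℝ) * Complex.I) := by
  obtain ⟨hxs, r, hr, hxr⟩ := hx
  have hn : 0 < r * ‖E.direction d‖ := mul_pos hr (norm_pos_iff.2 hd)
  have h : chartAt ℂ (E.start d) x = chartAt ℂ (E.start d) (E.start d) +
      Complex.exp ((Real.log (r * ‖E.direction d‖) : ℝ) + (α - θ : ℝ) * Complex.I) := by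
    rw [hxr, Complex.exp_add, ← Complex.ofReal_exp, Real.exp_log hn]
    push_cast
    rw [sub_mul, sub_eq_neg_add, Complex.exp_add, neg_mul]
    linear_combination (r * Complex.exp (-(θ * Complex.I))) * hα
  refine ⟨_, ?_, h⟩
  rw [logPolar, ← h, (chartAt ℂ (E.start d)).left_inv hxs]

theorem logPolar_mem_ray {d : E.OrientedEdge} {α θ ρ : ℝ} (hd : E.direction d ≠ 0)
    (hα : E.direction d = ‖E.direction d‖ * Complex.exp (α * Complex.I))
    (h : chartAt ℂ (E.start d) (E.start d) + Complex.exp (ρ + (α - θ : ℝ) * Complex.I) ∈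
      (chartAt ℂ (E.start d)).target) :
    logPolar (E.start d) (ρ + (α - θ : ℝ) * Complex.I) ∈ E.ray d θ := by
  have hn : 0 < ‖E.direction d‖ := norm_pos_iff.2 hd
  refine ⟨logPolar_mem_source h, Real.exp ρ / ‖E.direction d‖, div_pos (Real.exp_pos ρ) hn, ?_⟩
  rw [chartAt_logPolar h, hα, Complex.exp_add, ← Complex.ofReal_exp]
  have hn' : (‖E.direction d‖ : ℂ) ≠ 0 := by exact_mod_cast hn.ne'
  simp only [norm_mul, Complex.norm_real, norm_norm, Complex.norm_exp_ofReal_mul_I, mul_one]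
  push_cast
  rw [sub_mul, sub_eq_neg_add, Complex.exp_add, neg_mul]
  field_simp

end Rays

/-! ### Sectors at a point of `S`, their labels, and vertex collapse. -/

section Sectors

variable {S T G : Type*} [TopologicalSpace S] [T2Space S] [CompactSpace S]
  [TopologicalSpace T] [T2Space T] [ChartedSpace ℂ T] [IsManifold 𝓘(ℂ) ω T] [Group G] [Finite G]
  [MulAction G S] [ContinuousConstSMul G S] {p : S → T} {E : ArcSystem T} {x₀ w : S}
  {e : ℕ → E.OrientedEdge} {τ : E.OrientedEdge → G} {η L : ℝ} {φ : ℤ → ℝ → ℝ} {Ψ : ℂ → S} {s : G}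

/-- The local picture at `w`: lifted logarithmic polar coordinates `Ψ`, in which the lifts of the
edge ends at `p w` are the graphs of the functions `φ j`, and crossing an edge multiplies labels
on the right by `τ`. -/
structure IsSectorChart (E : ArcSystem T) (p : S → T) (x₀ w : S) (e : ℕ → E.OrientedEdge)
    (τ : E.OrientedEdge → G) (η L : ℝ) (φ : ℤ → ℝ → ℝ) (Ψ : ℂ → S) (s : G) : Prop where
  valence_pos : 0 < E.valence (p w)
  counterclockwise : E.IsCounterclockwise (p w) e
  eta_pos : 0 < η
  gap : ∀ j, E.intAngle (p w) e j + 2 * η ≤ E.intAngle (p w) e (j + 1)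
  target : ∀ ζ : ℂ, ζ.re < L → chartAt ℂ (p w) (p w) + Complex.exp ζ ∈ (chartAt ℂ (p w)).target
  tendsto : ∀ j, Tendsto (φ j) atBot (𝓝 (E.intAngle (p w) e j))
  close : ∀ ρ < L, ∀ j, |φ j ρ - E.intAngle (p w) e j| < η
  period : ∀ j n : ℤ, ∀ ρ, φ (j + n * E.valence (p w)) ρ = φ j ρ + n * (2 * Real.pi)
  crossing : ∀ ρ < L, ∀ j, ∃ t ∈ Ioo (0 : ℝ) 1, IsPositiveCrossing
    (E.path (E.intEdge (p w) e j)) t (fun u : ℝ => logPolar (p w) (ρ + u * Complex.I)) (φ j ρ)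
  carrier : ∀ ζ : ℂ, ζ.re < L → logPolar (p w) ζ ∈ E.carrier → ∃ j, ζ.im = φ j ζ.re
  lift : IsLogPolarLift p w L Ψ s
  label : ∀ d, ∀ t ∈ Ioo (0 : ℝ) 1, E.HasCrossing p x₀ d t (τ d)

/-- The sector between the `j`-th and the next edge end at `w` has label `g`. -/
def HasLabel (E : ArcSystem T) (p : S → T) (x₀ : S) (L : ℝ) (φ : ℤ → ℝ → ℝ) (Ψ : ℂ → S)
    (j : ℤ) (g : G) : Prop :=
  ∀ ρ < L, ∀ x ∈ Ioo (φ j ρ) (φ (j + 1) ρ), Ψ (ρ + x * Complex.I) ∈ g • E.polygon p x₀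

theorem re_add_mul_I (ρ x : ℝ) : (ρ + x * Complex.I : ℂ).re = ρ := by simp

theorem im_add_mul_I (ρ x : ℝ) : (ρ + x * Complex.I : ℂ).im = x := by simp

namespace IsSectorChart

/-- One angle lies in the sector at every radius below the bound; this is why the gap is `2 * η` and
the error less than `η`. -/
theorem angle_mem (H : E.IsSectorChart p x₀ w e τ η L φ Ψ s) {ρ : ℝ} (hρ : ρ < L) (j : ℤ) :
    E.intAngle (p w) e j + η ∈ Ioo (φ j ρ) (φ (j + 1) ρ) := by
  have h1 := abs_lt.1 (H.close ρ hρ j)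
  have h2 := abs_lt.1 (H.close ρ hρ (j + 1))
  have h3 := H.gap j
  constructor <;> linarith

theorem strictMono (H : E.IsSectorChart p x₀ w e τ η L φ Ψ s) {ρ : ℝ} (hρ : ρ < L) :
    StrictMono fun j => φ j ρ :=
  strictMono_int_of_lt_succ fun j => (H.angle_mem hρ j).1.trans (H.angle_mem hρ j).2

theorem notMem_carrier (H : E.IsSectorChart p x₀ w e τ η L φ Ψ s) {ρ : ℝ} (hρ : ρ < L) {j : ℤ}
    {x : ℝ} (hx : x ∈ Ioo (φ j ρ) (φ (j + 1) ρ)) : p (Ψ (ρ + x * Complex.I)) ∉ E.carrier := by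
  have hre : (ρ + x * Complex.I : ℂ).re < L := by rwa [re_add_mul_I]
  rw [H.lift.map_eq _ hre]
  intro hcar
  obtain ⟨i, hi⟩ := H.carrier _ hre hcar
  rw [im_add_mul_I, re_add_mul_I] at hi
  rw [hi] at hx
  have h1 := (H.strictMono hρ).lt_iff_lt.1 hx.1
  have h2 := (H.strictMono hρ).lt_iff_lt.1 hx.2
  omega

theorem continuousAt_lift (H : E.IsSectorChart p x₀ w e τ η L φ Ψ s) {ζ : ℂ} (hζ : ζ.re < L) :
    ContinuousAt Ψ ζ :=
  H.lift.continuousOn.continuousAt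
    ((isOpen_lt Complex.continuous_re continuous_const).mem_nhds hζ)

/-- A sector is connected: move along a circular arc to the angle of `angle_mem`, then along that
ray to another radius, then along an arc again, never meeting the graph. -/
theorem hasLabel_of_mem (H : E.IsSectorChart p x₀ w e τ η L φ Ψ s) (hp : IsOrbitMap G p) {j : ℤ}
    {g : G} {ρ x : ℝ} (hρ : ρ < L) (hx : x ∈ Ioo (φ j ρ) (φ (j + 1) ρ))
    (hg : Ψ (ρ + x * Complex.I) ∈ g • E.polygon p x₀) : E.HasLabel p x₀ L φ Ψ j g := by
  have hhor : ∀ ρ < L, ∀ x ∈ Ioo (φ j ρ) (φ (j + 1) ρ), ∀ y ∈ Ioo (φ j ρ) (φ (j + 1) ρ),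
      Ψ (ρ + x * Complex.I) ∈ g • E.polygon p x₀ → Ψ (ρ + y * Complex.I) ∈ g • E.polygon p x₀ := by
    intro ρ hρ x hx y hy
    refine mem_smul_polygon_of_isPreconnected (f := fun x : ℝ => Ψ (ρ + x * Complex.I)) hp
      isPreconnected_Ioo (fun u hu => ?_) (fun u hu => H.notMem_carrier hρ hu) hx hy
    refine (ContinuousAt.comp (g := Ψ) (H.continuousAt_lift ?_) ?_).continuousWithinAt
    · rwa [re_add_mul_I]
    · fun_prop
  have hver := hhor ρ hρ x hx _ (H.angle_mem hρ j) hg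
  intro ρ' hρ' y hy
  refine hhor ρ' hρ' _ (H.angle_mem hρ' j) y hy ?_
  refine mem_smul_polygon_of_isPreconnected
    (f := fun ρ : ℝ => Ψ (ρ + (E.intAngle (p w) e j + η : ℝ) * Complex.I)) hp
    isPreconnected_Iio (fun u hu => ?_) (fun u hu => H.notMem_carrier hu (H.angle_mem hu j))
    hρ hρ' hver
  refine (ContinuousAt.comp (g := Ψ) (H.continuousAt_lift ?_) ?_).continuousWithinAt
  · rwa [re_add_mul_I]
  · fun_prop

theorem hasLabel_unique (H : E.IsSectorChart p x₀ w e τ η L φ Ψ s) (hE : E.IsCutSystem G p)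
    (hp : IsOrbitMap G p) (hx₀ : p x₀ ∉ E.carrier) {j : ℤ} {g g' : G}
    (hg : E.HasLabel p x₀ L φ Ψ j g) (hg' : E.HasLabel p x₀ L φ Ψ j g') : g = g' := by
  obtain ⟨ρ, hρ⟩ := exists_lt L
  exact hE.smul_polygon_inj hp hx₀ (hg ρ hρ _ (H.angle_mem hρ j)) (hg' ρ hρ _ (H.angle_mem hρ j))

/-- The lifted circle of fixed radius crosses edge end `j + 1` from right to left, so the crossing
rule applies to it. -/
theorem hasLabel_succ (H : E.IsSectorChart p x₀ w e τ η L φ Ψ s) (hE : E.IsCutSystem G p)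
    (hp : IsOrbitMap G p) (hx₀ : p x₀ ∉ E.carrier) {j : ℤ} {g : G}
    (hg : E.HasLabel p x₀ L φ Ψ j g) :
    E.HasLabel p x₀ L φ Ψ (j + 1) (g * τ (E.intEdge (p w) e (j + 1))) := by
  obtain ⟨ρ, hρ⟩ := exists_lt L
  obtain ⟨t, ht, hcross⟩ := H.crossing ρ hρ (j + 1)
  have hre : ∀ u : ℝ, (ρ + u * Complex.I : ℂ).re < L := fun u => by rwa [re_add_mul_I]
  obtain ⟨g₁, h1, h2⟩ := H.label _ t ht _ _ (fun u : ℝ => Ψ (ρ + u * Complex.I)) hcross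
    (ContinuousAt.comp (g := Ψ) (H.continuousAt_lift (hre _)) (by fun_prop))
    (Eventually.of_forall fun u => H.lift.map_eq _ (hre u))
  obtain ⟨u, hu, hu'⟩ :=
    (h1.and (Ioo_mem_nhdsLT (H.strictMono hρ (lt_add_one j)))).exists
  obtain ⟨y, hy, hy'⟩ :=
    (h2.and (Ioo_mem_nhdsGT (H.strictMono hρ (lt_add_one (j + 1))))).exists
  have e1 : g₁ = g := hE.smul_polygon_inj hp hx₀ hu (hg ρ hρ u hu')
  subst e1
  exact H.hasLabel_of_mem hp hρ hy' hy

/-- A turn shifts sector indices by the valence and acts on points by `s`, hence on labels from the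
left, whereas crossings act from the right. -/
theorem hasLabel_turn (H : E.IsSectorChart p x₀ w e τ η L φ Ψ s) {j : ℤ} {g : G}
    (hg : E.HasLabel p x₀ L φ Ψ j g) (n : ℤ) :
    E.HasLabel p x₀ L φ Ψ (j + n * E.valence (p w)) (s ^ n * g) := by
  intro ρ hρ x hx
  rw [add_right_comm, H.period, H.period] at hx
  have h1 := hg ρ hρ (x - n * (2 * Real.pi)) ⟨by linarith [hx.1], by linarith [hx.2]⟩
  have h2 := H.lift.turn (ρ + (x - n * (2 * Real.pi) : ℝ) * Complex.I)
    (by rwa [re_add_mul_I]) n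
  have h3 : (ρ + (x - n * (2 * Real.pi) : ℝ) * Complex.I + n * (2 * Real.pi * Complex.I) : ℂ) =
      ρ + x * Complex.I := by
    push_cast
    ring
  rw [h3] at h2
  rw [h2]
  exact mul_smul_mem_mul_smul h1

/-- How small the radius has to be depends on `θ`, because the edge may bend clockwise across the
ray further out. -/
theorem eventually_mem_sector (H : E.IsSectorChart p x₀ w e τ η L φ Ψ s) (j : ℤ) {θ : ℝ}
    (hθ : θ ∈ Ioo 0 η) : ∀ᶠ ρ in atBot, ρ < L ∧
      E.intAngle (p w) e j - θ ∈ Ioo (φ (j - 1) ρ) (φ (j - 1 + 1) ρ) := by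
  filter_upwards [Iio_mem_atBot L, (H.tendsto j).eventually
    (lt_mem_nhds (sub_lt_self (E.intAngle (p w) e j) hθ.1))] with ρ hρ hρ'
  have h1 := abs_lt.1 (H.close ρ hρ (j - 1))
  have h2 := H.gap (j - 1)
  rw [sub_add_cancel] at h2 ⊢
  exact ⟨hρ, by linarith [hθ.2], hρ'⟩

theorem cornerAt (H : E.IsSectorChart p x₀ w e τ η L φ Ψ s) (hE : E.IsCutSystem G p) {j : ℤ}
    {g : G} (hg : E.HasLabel p x₀ L φ Ψ (j - 1) g) :
    E.CornerAt p x₀ g (E.intEdge (p w) e j) w := by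
  have hst := H.counterclockwise.start_intEdge H.valence_pos j
  refine ⟨hst.symm, ?_⟩
  filter_upwards [Ioo_mem_nhdsGT H.eta_pos] with θ hθ
  have hev := H.eventually_mem_sector j hθ
  refine mem_closure_of_tendsto (b := atBot)
    (f := fun ρ : ℝ => Ψ (ρ + (E.intAngle (p w) e j - θ : ℝ) * Complex.I)) ?_ ?_
  · intro N hN
    obtain ⟨L', hL'⟩ := H.lift.near N hN
    rw [mem_map]
    filter_upwards [Iio_mem_atBot L, Iio_mem_atBot L'] with ρ hρ hρ'
    exact hL' _ (by rwa [re_add_mul_I]) (by rwa [re_add_mul_I])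
  · filter_upwards [hev] with ρ hρ
    refine ⟨hg ρ hρ.1 _ hρ.2, ?_⟩
    have hre : (ρ + (E.intAngle (p w) e j - θ : ℝ) * Complex.I : ℂ).re < L := by
      rw [re_add_mul_I]
      exact hρ.1
    have hray := logPolar_mem_ray (θ := θ) (ρ := ρ) (hE.direction_ne_zero _)
      (hE.direction_intEdge (v := p w) (e := e) j) (by rw [hst]; exact H.target _ hre)
    rw [hst] at hray
    rw [mem_preimage, H.lift.map_eq _ hre]
    exact hray

/-- The closure condition supplies a point of the polygon on the ray, near `w`. Its lifted
coordinate may differ from that of the ray by `n` turns, and this determines which of the sectors of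
type `d` at `w` is meant. -/
theorem exists_hasLabel_of_cornerAt (H : E.IsSectorChart p x₀ w e τ η L φ Ψ s)
    (hE : E.IsCutSystem G p) (hp : IsOrbitMap G p) {d : E.OrientedEdge} {g : G}
    (hg : E.CornerAt p x₀ g d w) :
    ∃ j, E.intEdge (p w) e j = d ∧ E.HasLabel p x₀ L φ Ψ (j - 1) g := by
  obtain ⟨i, rfl⟩ := H.counterclockwise.exists_intEdge_eq hg.1.symm
  have hst := H.counterclockwise.start_intEdge H.valence_pos i
  obtain ⟨θ, hcl, hθ⟩ := (hg.2.and (Ioo_mem_nhdsGT H.eta_pos)).exists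
  obtain ⟨M, hM⟩ := eventually_atBot.1 (H.eventually_mem_sector i hθ)
  have hnear : ∀ᶠ x in 𝓝 w, ∀ ζ : ℂ, chartAt ℂ (p w) (p x) =
      chartAt ℂ (p w) (p w) + Complex.exp ζ → ζ.re < M :=
    hp.continuous.continuousAt.eventually (eventually_re_lt (p w) M)
  obtain ⟨x, ⟨hxs, hxn⟩, hxg, hxray⟩ := mem_closure_iff_nhds.1 hcl _ (inter_mem H.lift.surj hnear)
  have hα := hE.direction_intEdge (v := p w) (e := e) i
  obtain ⟨ρ, hxρ, hchart⟩ := exists_logPolar_of_mem_ray (hE.direction_ne_zero _) hα hxray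
  rw [hst] at hxρ hchart
  have hρM := hxn _ hchart
  rw [re_add_mul_I] at hρM
  obtain ⟨hρL, hsec⟩ := hM ρ hρM.le
  have hre : (ρ + (E.intAngle (p w) e i - θ : ℝ) * Complex.I : ℂ).re < L := by
    rwa [re_add_mul_I]
  have hxw : x ≠ w := by
    rintro rfl
    exact logPolar_ne (H.target _ hre) hxρ.symm
  obtain ⟨ζ, hζ, rfl⟩ := hxs hxw
  rw [H.lift.map_eq ζ hζ] at hxρ
  obtain ⟨n, rfl⟩ := (logPolar_eq_iff (H.target _ hζ) (H.target _ hre)).1 hxρ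
  rw [H.lift.turn _ hre] at hxg
  have h1 := mul_smul_mem_mul_smul (g' := s ^ (-n)) hxg
  rw [← mul_smul, ← zpow_add, neg_add_cancel, zpow_zero, one_smul] at h1
  have h2 := H.hasLabel_turn (H.hasLabel_of_mem hp hρL hsec h1) n
  refine ⟨i + n * E.valence (p w), intEdge_add_mul E (p w) e i n, ?_⟩
  rw [← mul_assoc, ← zpow_add, add_neg_cancel, zpow_zero, one_mul] at h2
  rwa [add_sub_right_comm]

/-- The sector of type `e n` precedes `e n`, so its index is `n - 1`; the starting sector of type `e
0` therefore has index `-1`. -/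
theorem hasLabel_labelSequence (H : E.IsSectorChart p x₀ w e τ η L φ Ψ s)
    (hE : E.IsCutSystem G p) (hp : IsOrbitMap G p) (hx₀ : p x₀ ∉ E.carrier) {h : G}
    (h0 : E.HasLabel p x₀ L φ Ψ (-1) h) (n : ℕ) :
    E.HasLabel p x₀ L φ Ψ (n - 1) (labelSequence h (fun n => τ (e n)) n) := by
  induction n with
  | zero => simpa [labelSequence] using h0
  | succ n ih =>
    have h1 := H.hasLabel_succ hE hp hx₀ ih
    rw [sub_add_cancel, H.counterclockwise.intEdge_natCast] at h1
    simpa [labelSequence] using h1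

/-- The order of `s` is `m`, so labels have period `k * m`, and sectors of one type within a period
have labels differing by nontrivial powers of `s`. -/
theorem vertexCollapse_iff (H : E.IsSectorChart p x₀ w e τ η L φ Ψ s)
    (hE : E.IsCutSystem G p) (hp : IsOrbitMap G p) (hx₀ : p x₀ ∉ E.carrier) {h : G}
    (h0 : E.HasLabel p x₀ L φ Ψ (-1) h) :
    E.VertexCollapse G p x₀ w ↔ ∃ i j : ℕ, i < j ∧
      j < E.valence (p w) * Nat.card (MulAction.stabilizer G w) ∧
      labelSequence h (fun n => τ (e n)) i = labelSequence h (fun n => τ (e n)) j := by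
  set k := E.valence (p w) with hk
  set m := Nat.card (MulAction.stabilizer G w) with hm
  have hsm : orderOf s = m := by rw [hm, ← H.lift.zpowers_eq, Nat.card_zpowers]
  have hk0 : 0 < k := H.valence_pos
  have hm0 : 0 < m := Nat.card_pos
  have hseq := H.hasLabel_labelSequence hE hp hx₀ h0
  constructor
  · rintro ⟨g, d, d', hdd', hd, hd'⟩
    -- The index of a corner is reduced modulo `k * m`. This is a shift by a multiple of `m` turns,
    -- and `s ^ m = 1`, so both the type and the label survive.
    have key : ∀ d : E.OrientedEdge, E.CornerAt p x₀ g d w → ∃ i : ℕ, i < k * m ∧ e i = d ∧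
        labelSequence h (fun n => τ (e n)) i = g := by
      intro d hd
      obtain ⟨j, rfl, hj⟩ := H.exists_hasLabel_of_cornerAt hE hp hd
      have hlt := toNat_emod_lt (Nat.mul_pos hk0 hm0) j
      have hcast : ((j % ((k * m : ℕ) : ℤ)).toNat : ℤ) =
          j + (-(m * (j / ((k * m : ℕ) : ℤ)))) * k := by
        rw [Int.toNat_of_nonneg (Int.emod_nonneg j (by exact_mod_cast (Nat.mul_pos hk0 hm0).ne'))]
        have := Int.emod_add_mul_ediv j ((k * m : ℕ) : ℤ)
        generalize j / ((k * m : ℕ) : ℤ) = q at *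
        push_cast at *
        linarith
      refine ⟨_, hlt, ?_, ?_⟩
      · rw [← H.counterclockwise.intEdge_natCast, hcast, intEdge_add_mul]
      · refine H.hasLabel_unique hE hp hx₀ (hseq _) ?_
        have h1 := H.hasLabel_turn hj (-(m * (j / ((k * m : ℕ) : ℤ))))
        have h2 : s ^ (-((m : ℤ) * (j / ((k * m : ℕ) : ℤ)))) = 1 := by
          rw [zpow_neg, zpow_mul, zpow_natCast, ← hsm, pow_orderOf_eq_one, one_zpow, inv_one]
        rw [h2, one_mul] at h1
        rwa [hcast, add_sub_right_comm]
    obtain ⟨i, hi, hid, hig⟩ := key d hd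
    obtain ⟨j, hj, hjd, hjg⟩ := key d' hd'
    rcases lt_trichotomy i j with hij | rfl | hij
    · exact ⟨i, j, hij, hj, hig.trans hjg.symm⟩
    · exact absurd (hid.symm.trans hjd) hdd'
    · exact ⟨j, i, hij, hi, hjg.trans hig.symm⟩
  · rintro ⟨i, j, hij, hj, heq⟩
    have hcor : ∀ n : ℕ, E.CornerAt p x₀ (labelSequence h (fun n => τ (e n)) n) (e n) w := by
      intro n
      rw [← H.counterclockwise.intEdge_natCast n]
      exact H.cornerAt hE (hseq n)
    refine ⟨_, e i, e j, ?_, hcor i, heq ▸ hcor j⟩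
    -- If the types agreed, then `j = i + k * q` with `0 < q < m`. Equality of the labels would
    -- force `s ^ q = 1`, against the order of `s`.
    intro hee
    rw [← H.counterclockwise.intEdge_natCast i, ← H.counterclockwise.intEdge_natCast j] at hee
    have hmod := H.counterclockwise.enumerates.injOn (toNat_emod_lt hk0 (i : ℤ))
      (toNat_emod_lt hk0 (j : ℤ)) hee
    rw [← Int.natCast_mod, ← Int.natCast_mod, Int.toNat_natCast, Int.toNat_natCast] at hmod
    obtain ⟨q, hq⟩ := (Nat.modEq_iff_dvd' hij.le).1 hmod
    have hjq : j = i + k * q := by omega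
    have hq0 : q ≠ 0 := by
      rintro rfl
      omega
    have hqm : q < m := by
      by_contra hge
      have := Nat.mul_le_mul_left k (not_lt.1 hge)
      omega
    have h1 := H.hasLabel_turn (hseq i) q
    have h2 : ((i : ℤ) - 1 + (q : ℤ) * k) = (j : ℤ) - 1 := by
      rw [hjq]
      push_cast
      ring
    rw [h2] at h1
    have h3 := H.hasLabel_unique hE hp hx₀ h1 (hseq j)
    rw [← heq, mul_eq_right, zpow_natCast] at h3
    have := orderOf_le_of_pow_eq_one (Nat.pos_of_ne_zero hq0) h3
    omega

end IsSectorChart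

variable [ChartedSpace ℂ S]

theorem IsCutSystem.exists_isSectorChart (hE : E.IsCutSystem G p) (hp : IsOrbitMap G p)
    (hw : p w ∈ E.vertices) (he : E.IsCounterclockwise (p w) e) (hk : 0 < E.valence (p w))
    (hτ : ∀ d, ∀ t ∈ Ioo (0 : ℝ) 1, E.HasCrossing p x₀ d t (τ d)) {h : G}
    (hh : E.CornerAt p x₀ h (e 0) w) :
    ∃ (η L : ℝ) (φ : ℤ → ℝ → ℝ) (Ψ : ℂ → S) (s : G),
      E.IsSectorChart p x₀ w e τ η L φ Ψ s ∧ E.HasLabel p x₀ L φ Ψ (-1) h := by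
  obtain ⟨η, hη, hgap⟩ := he.exists_gap hk (hE.direction_ne_zero _)
  obtain ⟨L₀, φ, htar, htend, hclose, hper, hcross, hcar⟩ := hE.exists_sectors hw he hk hη
  obtain ⟨L, hLL₀, N, hN, hlift⟩ := hp.exists_isLogPolarLift w fun ζ hζ =>
    ⟨(htar ζ hζ).1, hE.not_isConePoint (htar ζ hζ).2⟩
  have he0 : E.intEdge (p w) e 0 = e 0 := by simpa using he.intEdge_natCast 0
  have hst := he.start_intEdge hk 0
  have hα := hE.direction_intEdge (v := p w) (e := e) 0
  rw [he0] at hst hα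
  obtain ⟨θ, hcl, hθ⟩ := (hh.2.and (Ioo_mem_nhdsGT hη)).exists
  have hsec : ∀ᶠ ρ in atBot, ρ < L ∧
      E.intAngle (p w) e 0 - θ ∈ Ioo (φ (-1) ρ) (φ (-1 + 1) ρ) := by
    filter_upwards [Iio_mem_atBot L, (htend 0).eventually
      (lt_mem_nhds (sub_lt_self (E.intAngle (p w) e 0) hθ.1))] with ρ hρ hρ'
    have h1 := abs_lt.1 (hclose ρ (lt_of_lt_of_le hρ hLL₀) (-1))
    have h2 := hgap (-1)
    rw [neg_add_cancel] at h2 ⊢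
    exact ⟨hρ, by linarith [hθ.2], hρ'⟩
  obtain ⟨M, hM⟩ := eventually_atBot.1 hsec
  have hnear : ∀ᶠ x in 𝓝 w, ∀ ζ : ℂ, chartAt ℂ (p w) (p x) =
      chartAt ℂ (p w) (p w) + Complex.exp ζ → ζ.re < M :=
    hp.continuous.continuousAt.eventually (eventually_re_lt (p w) M)
  obtain ⟨x, ⟨hxN, hxn⟩, hxh, hxray⟩ := mem_closure_iff_nhds.1 hcl _ (inter_mem hN hnear)
  obtain ⟨ρ, hxρ, hchart⟩ := exists_logPolar_of_mem_ray (hE.direction_ne_zero _) hα hxray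
  rw [hst] at hxρ hchart
  have hρM := hxn _ hchart
  rw [re_add_mul_I] at hρM
  obtain ⟨hρL, hmem⟩ := hM ρ hρM.le
  -- The lift is normalized to pass through a point that witnesses the corner hypothesis on `h`, so
  -- the sector with index `-1` gets the label `h`.
  obtain ⟨Ψ, s, hΨ, hΨx⟩ := hlift x hxN _ (by rwa [re_add_mul_I]) hxρ
  have H : E.IsSectorChart p x₀ w e τ η L φ Ψ s :=
    ⟨hk, he, hη, hgap, fun ζ hζ => (htar ζ (hζ.trans_le hLL₀)).1, htend,
      fun ρ hρ => hclose ρ (hρ.trans_le hLL₀), hper, fun ρ hρ => hcross ρ (hρ.trans_le hLL₀),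
      fun ζ hζ => hcar ζ (hζ.trans_le hLL₀), hΨ, hτ⟩
  exact ⟨η, L, φ, Ψ, s, H, H.hasLabel_of_mem hp hρL hmem (by rw [hΨx]; exact hxh)⟩

end Sectors

end ArcSystem

/-! ### The theorem for conformal quotients. -/

theorem IsConformalQuotient.isOrbitMap {G S T : Type*} [Group G] [MulAction G S]
    [TopologicalSpace S] [ChartedSpace ℂ S] [TopologicalSpace T] [ChartedSpace ℂ T] {p : S → T}
    (hp : IsConformalQuotient G p) : IsOrbitMap G p :=
  ⟨hp.holomorphic.continuous, hp.surjective, hp.fibre⟩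

theorem mainTheorem5 {S T G : Type*}
    [TopologicalSpace S] [T2Space S] [CompactSpace S] [ConnectedSpace S]
    [ChartedSpace ℂ S] [IsManifold 𝓘(ℂ) ω S]
    [TopologicalSpace T] [T2Space T] [ChartedSpace ℂ T] [IsManifold 𝓘(ℂ) ω T]
    [Group G] [Finite G] [MulAction G S] [FaithfulSMul G S]
    (p : S → T) (hp : IsConformalQuotient G p)
    (E : ArcSystem T) (hE : E.IsCutSystem G p)
    (x₀ : S) (hx₀ : p x₀ ∉ E.carrier)
    (δ : E.OrientedEdge → Path (p x₀) (p x₀)) (hδ : ∀ d, E.IsCrossoverLoop d (δ d))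
    (v : S) (hv : p v ∈ E.vertices)
    (e : ℕ → E.OrientedEdge) (he : E.IsCounterclockwise (p v) e)
    (h : G) (hh : E.CornerAt p x₀ h (e 0) v) :
    E.VertexCollapse G p x₀ v ↔
      ∃ i j : ℕ, i < j ∧ j < E.valence (p v) * Nat.card (MulAction.stabilizer G v) ∧
        labelSequence h (fun n => monodromy G p x₀ (δ (e n))) i =
          labelSequence h (fun n => monodromy G p x₀ (δ (e n))) j := by
  have : ContinuousConstSMul G S := ⟨fun g => (hp.conformal g).continuous⟩
  have hq := hp.isOrbitMap
  -- Positivity comes from the corner hypothesis, by which `e 0` issues from `p v`; the listing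
  -- alone is vacuous at valence `0`.
  have hk : 0 < E.valence (p v) := (Set.ncard_pos (Set.toFinite _)).2 ⟨e 0, hh.1.symm⟩
  obtain ⟨η, L, φ, Ψ, s, H, h0⟩ := hE.exists_isSectorChart hq hv he hk
    (τ := fun d => monodromy G p x₀ (δ d))
    (fun d t ht => (hδ d).hasCrossing_monodromy hE hq hx₀ ht) hh
  exact H.vertexCollapse_iff hE hq hx₀ h0
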